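/- **The game.** Two players $A,B$ play the following recursive contract, written in BitML with renegotiation. At time $0$ each player has deposited $3$ BTC into the contract $\mathit{CFG}$ and has committed to a secret ($a$ for $A$, $b$ for $B$; a committed secret is a natural number, or an invalid value $\bot$ that can never be revealed). With $\mathtt{put}\,\vec s\,[p].\,C$ meaning "once the secrets $\vec s$ are revealed and satisfy $p$, continue as $C$", $+$ meaning choice, $t:D$ meaning "$D$, executable only from time $t$ on", and $\mathtt{rngt}\,X$ meaning renegotiation, $$\mathit{CFG}=\mathtt{put}\,b\,[0\le b\le 1].\big(\mathtt{put}\,ab\,[a=b].(\mathtt{rngt}\,X_A(1)+3:\mathit{Split}_A)+\mathtt{put}\,ab\,[a\ne b].(\mathtt{rngt}\,X_B(1)+3:\mathit{Split}_B)+2:\mathtt{withdraw}\,B\big)+1:\mathtt{withdraw}\,A,$$ $$X_A(n)=\mathtt{put}\,b\,[0\le b\le 1].\big(\mathtt{put}\,ab\,[a=b].\mathtt{withdraw}\,A+\mathtt{put}\,ab\,[a\ne b].(\mathtt{rngt}\,X_B(n{+}1)+(3n{+}3):\mathit{Split}_B)+(3n{+}2):\mathtt{withdraw}\,B\big)+(3n{+}1):\mathtt{withdraw}\,A,$$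 $$X_B(n)=\mathtt{put}\,b\,[0\le b\le 1].\big(\mathtt{put}\,ab\,[a=b].(\mathtt{rngt}\,X_A(n{+}1)+(3n{+}3):\mathit{Split}_A)+\mathtt{put}\,ab\,[a\ne b].\mathtt{withdraw}\,B+(3n{+}2):\mathtt{withdraw}\,B\big)+(3n{+}1):\mathtt{withdraw}\,A,$$ where $\mathit{Split}_P$ splits the pot of $6$ BTC into $4$ BTC withdrawable by $P$ and $2$ BTC withdrawable by the other player. A renegotiation is advertised; then each player commits to a fresh secret; then each player may authorize it; when both have authorized it, it may replace the current contract, provided that no alternative branch has been taken meanwhile. Committing, authorizing, and revealing (possible after stipulation only) can be done only by the player concerned; all other actions can be done by anyone. Time is discrete. **Rational player.** A player $P$ is rational if * each secret of $P$ is a fresh uniform element of $\{0,1\}$: the secrets of different rounds are independent, and independent of all other randomness, and $P$'s behaviour does not depend on a secret until the contract it belongs to has been stipulated; * $P$ does not let time advance while an executable withdrawal in favour of $P$, or an executable $\mathit{Split}$, has not been taken (thus $P$ takes the $\mathit{Split}$ branch if renegotiation does not complete in time); * $P$ reveals in time: if after the next unit of time the other player could withdraw the pot through a branch alternative to a $\mathtt{put}$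 that uses $P$'s secret, then $P$ first reveals the secret and executes the corresponding enabled $\mathtt{put}$ branch. Otherwise $P$ is free, e.g. in accepting or refusing renegotiations. **Theorem.** Let $P\in\{A,B\}$ play a rational strategy, possibly randomized, against an arbitrary, possibly randomized, strategy of the other player. The other player also schedules the actions of both players, does not see the unrevealed secrets of $P$, and may commit to any secrets, or to $\bot$. Assume that time almost surely diverges along the play. Let the payoff of $P$ be the total amount that $P$ withdraws minus the deposit of $3$ BTC. Then the payoff of $P$ is integrable and its expectation is non-negative. Moreover, $p=4$ (the amount that $\mathit{Split}_P$ gives to $P$) is the unique real solution of $p=\tfrac12\cdot 6+\tfrac12\cdot(\tfrac12\cdot p)$. -/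

import Mathlib

open MeasureTheory

namespace BitML

/-! Syntax: two participants `A`, `B`; every stipulated contract comes with one committed secret of
each participant, so that a secret name (`a` or `b`) is identified with its owner. -/

inductive Player
  | A
  | B
  deriving DecidableEq

def Player.other : Player → Player
  | .A => .B
  | .B => .A

/-- Expressions: integer constants, secrets, sums and differences. -/
inductive Expr
  | const (k : ℤ)
  | secret (P : Player)
  | add (e f : Expr)
  | sub (e f : Expr)

inductive Pred
  | tt
  | and (p q : Pred)
  | not (p : Pred)
  | eq (e f : Expr)
  | lt (e f : Expr)

def Expr.eval (v : Player → ℤ) : Expr → ℤ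
  | .const k => k
  | .secret P => v P
  | .add e f => e.eval v + f.eval v
  | .sub e f => e.eval v - f.eval v

def Pred.eval (v : Player → ℤ) : Pred → Bool
  | .tt => true
  | .and p q => p.eval v && q.eval v
  | .not p => !(p.eval v)
  | .eq e f => decide (e.eval v = f.eval v)
  | .lt e f => decide (e.eval v < f.eval v)

/-- Recursion variables. -/
inductive RecVar
  | XA
  | XB
  deriving DecidableEq

/-- Guarded contracts; a contract is a choice (a list) of guarded contracts. -/
inductive Guarded
  /-- reveal the secrets `ss`, check `p`, continue as `C` -/
  | put (ss : List Player) (p : Pred) (C : List Guarded)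
  /-- transfer the whole balance to `P` -/
  | withdraw (P : Player)
  /-- split the balance -/
  | split (parts : List (ℕ × List Guarded))
  /-- wait until time `d` -/
  | after (d : ℕ) (D : Guarded)
  /-- renegotiate the contract as the call of `X` with argument `k` -/
  | rngt (X : RecVar) (k : ℕ)

abbrev Contract := List Guarded

/-- The earliest time at which a guarded contract can be executed. -/
def Guarded.release : Guarded → ℕ
  | .after d D => max d D.release
  | _ => 0

/-- The guarded contract without its time decorations. -/
def Guarded.core : Guarded → Guarded
  | .after _ D => D.core
  | D => D

/-! The coin flipping game. -/

/-- `0 ≤ b ≤ 1` -/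
def bitB : Pred :=
  .and (.not (.lt (.secret .B) (.const 0))) (.not (.lt (.const 1) (.secret .B)))

/-- `a = b` -/
def sameAB : Pred := .eq (.secret .A) (.secret .B)

/-- `4` to the winner `W` of the last flip and `2` to the other player. -/
def splitFor (W : Player) : Guarded :=
  .split [(4, [.withdraw W]), (2, [.withdraw W.other])]

def CFG : Contract :=
  [ .put [.B] bitB
      [ .put [.A, .B] sameAB [.rngt .XA 1, .after 3 (splitFor .A)],
        .put [.A, .B] (.not sameAB) [.rngt .XB 1, .after 3 (splitFor .B)],
        .after 2 (.withdraw .B) ],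
    .after 1 (.withdraw .A) ]

/-- The defining equations; both preconditions ask exactly for a fresh secret `a` of `A` and a fresh
secret `b` of `B`, and for no deposits. -/
def defn : RecVar → ℕ → Contract
  | .XA, n =>
    [ .put [.B] bitB
        [ .put [.A, .B] sameAB [.withdraw .A],
          .put [.A, .B] (.not sameAB) [.rngt .XB (n + 1), .after (3 * n + 3) (splitFor .B)],
          .after (3 * n + 2) (.withdraw .B) ],
      .after (3 * n + 1) (.withdraw .A) ]
  | .XB, n =>
    [ .put [.B] bitB
        [ .put [.A, .B] sameAB [.rngt .XA (n + 1), .after (3 * n + 3) (splitFor .A)],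
          .put [.A, .B] (.not sameAB) [.withdraw .B],
          .after (3 * n + 2) (.withdraw .B) ],
      .after (3 * n + 1) (.withdraw .A) ]

/-! Configurations and their transitions. -/

/-- A secret that has been committed (`none` stands for the invalid secret `⊥`) or revealed. -/
inductive Commitment
  | committed (N : Option ℕ)
  | revealed (N : ℕ)

/-- An active contract; its secret names `a`, `b` denote the secrets of `session`. -/
structure Active where
  body : Contract
  balance : ℕ
  session : ℕ

/-- An advertised renegotiation of the active contract `parent` as the call of `var` with `arg`,
with the authorizations given so far. -/
structure Advert where
  parent : ℕ
  var : RecVar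
  arg : ℕ
  auth : Player → Bool

/-- Timed configurations. Active contracts and advertisements are indexed by their names, and
`fresh` and all larger numbers are unused names. An advertisement named `s` becomes, when it is
stipulated, a contract whose secrets are those of session `s`. -/
structure Config where
  time : ℕ
  fresh : ℕ
  active : ℕ → Option Active
  advert : ℕ → Option Advert
  secret : ℕ → Player → Option Commitment
  /-- the total amount withdrawn so far by each player -/
  received : Player → ℕ

/-- The moves. `commit`, `authorize` and `reveal` can be performed only by the named player;
`fire`, `advertise` and `init` by anyone. A longer delay is a sequence of `tick`s. -/
inductive Move
  /-- one unit of time passes -/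
  | tick
  /-- execute the put, withdraw or split that is the `i`-th branch of contract `x` -/
  | fire (x i : ℕ)
  /-- advertise the renegotiation that is the `i`-th branch of contract `x` -/
  | advertise (x i : ℕ)
  /-- `P` commits to a secret for the advertisement `s` -/
  | commit (P : Player) (s : ℕ)
  /-- `P` authorizes the stipulation of the advertisement `s` -/
  | authorize (P : Player) (s : ℕ)
  /-- the advertisement `s` replaces the contract it renegotiates -/
  | init (s : ℕ)
  /-- `P` reveals the secret of session `s` -/
  | reveal (P : Player) (s : ℕ)

def Config.revealed? (c : Config) (s : ℕ) (P : Player) : Option ℕ :=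
  match c.secret s P with
  | some (.revealed N) => some N
  | _ => none

/-- Contract `x` is replaced by the contracts `parts`, with fresh names. -/
def Config.spawn (c : Config) (x s : ℕ) (parts : List (ℕ × Contract)) : Config :=
  { c with
    active := fun y =>
      if y = x then none
      else if y < c.fresh then c.active y
      else (parts[y - c.fresh]?).map fun q => ⟨q.2, q.1, s⟩
    fresh := c.fresh + parts.length }

def Config.setSecret (c : Config) (s : ℕ) (P : Player) (k : Commitment) : Config :=
  { c with secret := Function.update c.secret s (Function.update (c.secret s) P (some k)) }

def Config.fire (c : Config) (x i : ℕ) : Option Config :=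
  match c.active x with
  | none => none
  | some a =>
    match a.body[i]? with
    | none => none
    | some D =>
      if D.release ≤ c.time then
        match D.core with
        | .put ss p C =>
          if (ss.all fun P => (c.revealed? a.session P).isSome) &&
              p.eval (fun P => (((c.revealed? a.session P).getD 0 : ℕ) : ℤ)) then
            some (c.spawn x a.session [(a.balance, C)])
          else none
        | .withdraw P =>
          some { c.spawn x a.session [] with
            received := Function.update c.received P (c.received P + a.balance) }
        | .split parts =>
          if (parts.map Prod.fst).sum = a.balance then some (c.spawn x a.session parts) else none
        | _ => none
      else none

def Config.advertise (c : Config) (x i : ℕ) : Option Config :=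
  match c.active x with
  | none => none
  | some a =>
    match a.body[i]? with
    | none => none
    | some D =>
      if D.release ≤ c.time then
        match D.core with
        | .rngt X k =>
          if ∀ s < c.fresh, ∀ d ∈ c.advert s, ¬(d.parent = x ∧ d.var = X ∧ d.arg = k) then
            some { c with
              advert := Function.update c.advert c.fresh (some ⟨x, X, k, fun _ => false⟩)
              fresh := c.fresh + 1 }
          else none
        | _ => none
      else none

/-- The stipulation of a renegotiation needs the authorizations of both players. -/
def Config.init (c : Config) (s : ℕ) : Option Config :=
  match c.advert s with
  | none => none
  | some d =>
    match c.active d.parent with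
    | none => none
    | some a =>
      if d.auth .A && d.auth .B then
        some { c.spawn d.parent s [(a.balance, defn d.var d.arg)] with
          advert := Function.update c.advert s none }
      else none

/-- The configuration reached by a move, if the move is enabled; `N` is the secret that is chosen
if the move is a commitment. Secrets can be revealed after stipulation only. -/
def Config.step (c : Config) (m : Move) (N : Option ℕ) : Option Config :=
  match m with
  | .tick => some { c with time := c.time + 1 }
  | .fire x i => c.fire x i
  | .advertise x i => c.advertise x i
  | .commit P s =>
    match c.advert s, c.secret s P with
    | some _, none => some (c.setSecret s P (.committed N))
    | _, _ => none
  | .authorize P s =>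
    match c.advert s, c.secret s .A, c.secret s .B with
    | some d, some _, some _ =>
      some { c with
        advert := Function.update c.advert s
          (some { d with auth := Function.update d.auth P true }) }
    | _, _, _ => none
  | .init s => c.init s
  | .reveal P s =>
    match c.advert s, c.secret s P with
    | none, some (.committed (some N)) => some (c.setSecret s P (.revealed N))
    | _, _ => none

def Config.Enabled (c : Config) (m : Move) : Prop := (c.step m none).isSome

/-- The game just after stipulation, at time `0`: each player has paid a deposit of `3` into the
contract and has committed to a secret. -/
def start (N : Player → Option ℕ) : Config where
  time := 0
  fresh := 1
  active := fun y => if y = 0 then some ⟨CFG, 3 + 3, 0⟩ else none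
  advert := fun _ => none
  secret := fun s P => if s = 0 then some (.committed (N P)) else none
  received := fun _ => 0

/-! Strategies. -/

/-- The configuration as seen by someone who knows the unrevealed secrets in `vis` only. -/
def Config.hide (c : Config) (vis : ℕ → Player → Bool) : Config :=
  { c with
    secret := fun s R =>
      match c.secret s R with
      | some (.committed N) => some (.committed (if vis s R then N else none))
      | k => k }

/-- What the opponent of `P` sees: all but the unrevealed secrets of `P`. -/
def Config.opponentView (P : Player) (c : Config) : Config :=
  c.hide fun _ R => decide (R ≠ P)

/-- What the behaviour of `P` may depend on: all but the unrevealed secrets of the opponent and, as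
long as a (re)negotiation is pending, the secret that `P` has drawn for it. -/
def Config.ownView (P : Player) (c : Config) : Config :=
  c.hide fun s R => decide (R = P) && (c.advert s).isNone

/-- A strategy maps the observed history, latest configuration first, to the set of moves that the
player is willing to make, or, for `tick`, to accept. -/
abbrev Strategy := List Config → Set Move

/-- The opponent, who also schedules the moves of both players: the secret chosen at the start and,
for each observed history (latest configuration first), the next move, with the secret to be
committed if that move is a commitment of the opponent. -/
structure Opponent where
  secret : Option ℕ
  next : List Config → Move × Option ℕ

/-- The moves that only `P` can perform. -/
def Move.OwnedBy (P : Player) : Move → Prop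
  | .commit R _ => R = P
  | .authorize R _ => R = P
  | .reveal R _ => R = P
  | _ => False

/-- The opponent of `P` can choose a move offered by `P`, or any move that is not owned by `P`;
but time advances only if `P` lets it. -/
def Allowed (P : Player) (offers : Set Move) (m : Move) : Prop :=
  m ∈ offers ∨ (m ≠ .tick ∧ ¬ m.OwnedBy P)

/-- The secret used by a commitment: the commitments of `P` use the coin of their session. -/
def chosen (P : Player) (coin : ℕ → Bool) (m : Move) (N : Option ℕ) : Option ℕ :=
  match m with
  | .commit R s => if R = P then some (coin s).toNat else N
  | _ => N

open Classical in
/-- The current configuration and the list of the past ones, latest first, after `n` steps of the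
play of `P` with strategy `σ` against `τ`, where the secret of `P` in session `s` is `coin s`.
A step in which `τ` chooses a move that is not possible has no effect. -/
noncomputable def play (P : Player) (σ : Strategy) (τ : Opponent) (coin : ℕ → Bool) :
    ℕ → Config × List Config
  | 0 => (start fun R => if R = P then some (coin 0).toNat else τ.secret, [])
  | n + 1 =>
    let c := (play P σ τ coin n).1
    let h := c :: (play P σ τ coin n).2
    let mN := τ.next (h.map (Config.opponentView P))
    if Allowed P (σ (h.map (Config.ownView P))) mN.1 then
      ((c.step mN.1 (chosen P coin mN.1 mN.2)).getD c, h)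
    else (c, h)

/-- After the next unit of time, the opponent of `P` could withdraw the balance of `a`. -/
def Threat (P : Player) (c : Config) (a : Active) : Prop :=
  ∃ D ∈ a.body, D.core = .withdraw P.other ∧ D.release ≤ c.time + 1

/-- The moves that a rational player `P` makes before any more time passes: withdrawals in favour
of `P`, splits, and, if otherwise a withdrawal by the opponent would become possible, the
revelation of the secret of `P` and the execution of the branch that uses it. -/
inductive Due (P : Player) (c : Config) : Move → Prop
  | withdraw {x i : ℕ} {a : Active} {D : Guarded} (hx : c.active x = some a)
      (hi : a.body[i]? = some D) (hD : D.core = .withdraw P) (he : c.Enabled (.fire x i)) :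
      Due P c (.fire x i)
  | split {x i : ℕ} {a : Active} {D : Guarded} {parts : List (ℕ × Contract)}
      (hx : c.active x = some a) (hi : a.body[i]? = some D) (hD : D.core = .split parts)
      (he : c.Enabled (.fire x i)) :
      Due P c (.fire x i)
  | reveal {x i : ℕ} {a : Active} {D : Guarded} {ss : List Player} {p : Pred} {C : Contract}
      (hx : c.active x = some a) (hi : a.body[i]? = some D) (hD : D.core = .put ss p C)
      (hs : P ∈ ss) (ht : Threat P c a) (he : c.Enabled (.reveal P a.session)) :
      Due P c (.reveal P a.session)
  | put {x i : ℕ} {a : Active} {D : Guarded} {ss : List Player} {p : Pred} {C : Contract}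
      (hx : c.active x = some a) (hi : a.body[i]? = some D) (hD : D.core = .put ss p C)
      (hs : P ∈ ss) (ht : Threat P c a) (he : c.Enabled (.fire x i)) :
      Due P c (.fire x i)

/-- A rational player makes all moves that are due, and lets time advance only if none is due; any
other behaviour, such as accepting or refusing a renegotiation, is free. (That the secrets are
uniform in `{0, 1}` is part of `play` and `fairCoins`.) -/
structure Rational (P : Player) (σ : Strategy) : Prop where
  due : ∀ (c : Config) (h : List Config) (m : Move), Due P c m → m ∈ σ (c :: h)
  tick : ∀ (c : Config) (h : List Config), .tick ∈ σ (c :: h) → ∀ m, ¬ Due P c m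

/-- Independent uniform bits. -/
noncomputable def fairCoins : Measure (ℕ → Bool) :=
  Measure.infinitePi fun _ => (PMF.uniformOfFintype Bool).toMeasure

def TimeDiverges (run : ℕ → Config × List Config) : Prop :=
  ∀ t : ℕ, ∃ n : ℕ, t ≤ (run n).1.time

/-- The total amount that `P` withdraws in the play, minus the deposit of `3`. (The amount withdrawn
is nondecreasing along the play, and bounded by the pot of `6`.) -/
noncomputable def payoff (P : Player) (run : ℕ → Config × List Config) : ℝ :=
  (⨆ n : ℕ, ((run n).1.received P : ℝ)) - 3

end BitML

namespace BitML

/-! ### Phases of the game -/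

/-! The proof follows a potential: the amount `P` has received plus, for each active contract, a
value that `P` can secure. A pending renegotiation is worth 4 if `P` won the last flip and 2
otherwise, since `P` can fall back on the split. Playing another round preserves these values on
average: (6 + 2) / 2 = 4 after a win and (0 + 4) / 2 = 2 after a loss. The opening flip is worth (4
+ 2) / 2 = 3, the deposit. Once both secrets are committed, the flip has a determined `winner`, an
opponent who cannot reveal a valid secret being counted as the loser.

Every move other than a stipulation keeps the potential from dropping, with certainty (`Inv.step`):
a rational `P` acts before any withdrawal against `P` becomes executable, and the invariant `Inv`
records this as deadlines. A stipulation keeps it from dropping on average over the bit that `P` has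
drawn for the new round (`Inv.init_average`). Non-interference (`play_flipAt`) turns this into a
statement about expectations: flipping the coin of a session not yet stipulated changes the play
only by swapping a secret that neither strategy sees, and flipping a coin preserves the measure.
Hence no step of the play lowers the expected potential (`le_integral_potential`).

Value could still be carried along forever by repeated renegotiation without being received.
Therefore rounds from a horizon `K` on are counted as worthless, at the price of a deficit that
doubles with each round and costs 8 / 2 ^ `K` at the start. After time 3 `K` stipulations no longer
lower the potential, and at the next tick all of it has been received (`Inv.potential_eq_received`).
So `P` receives at least 3 - 8 / 2 ^ `K` in expectation, and `K` is arbitrary. -/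

@[simp] theorem Player.other_other (P : Player) : P.other.other = P := by cases P <;> rfl

@[simp] theorem Player.other_ne (P : Player) : P.other ≠ P := by cases P <;> decide

theorem Player.eq_other_of_ne {P Q : Player} (h : Q ≠ P) : Q = P.other := by
  cases P <;> cases Q <;> first | rfl | exact absurd rfl h

def RecVar.owner : RecVar → Player
  | .XA => .A
  | .XB => .B

def Player.recVar : Player → RecVar
  | .A => .XA
  | .B => .XB

/-- What follows round `n`, called by its previous winner `L`, when the flip is won by `W`. -/
def contBody (L : Option Player) (n : ℕ) (W : Player) : Contract :=
  if L = some W then [.withdraw W] else [.rngt W.recVar (n + 1), .after (3 * n + 3) (splitFor W)]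

def flipBody (L : Option Player) (n : ℕ) : Contract :=
  [.put [.A, .B] sameAB (contBody L n .A), .put [.A, .B] (.not sameAB) (contBody L n .B),
    .after (3 * n + 2) (.withdraw .B)]

/-- The forms of the contracts that can occur in a play. -/
inductive Phase
  | round (L : Option Player) (n : ℕ)
  | flip (L : Option Player) (n : ℕ)
  | wait (n : ℕ) (W : Player)
  | leaf (W : Player)

def Phase.body : Phase → Contract
  | .round L n => [.put [.B] bitB (flipBody L n), .after (3 * n + 1) (.withdraw .A)]
  | .flip L n => flipBody L n
  | .wait n W => [.rngt W.recVar (n + 1), .after (3 * n + 3) (splitFor W)]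
  | .leaf W => [.withdraw W]

/-- The phase that follows round `n` when the flip is won by `W`. -/
def contPhase (L : Option Player) (n : ℕ) (W : Player) : Phase :=
  if L = some W then .leaf W else .wait n W

theorem body_contPhase (L : Option Player) (n : ℕ) (W : Player) :
    (contPhase L n W).body = contBody L n W := by
  unfold contPhase contBody
  split_ifs <;> rfl

theorem CFG_eq : CFG = (Phase.round none 0).body := rfl

theorem defn_eq (X : RecVar) (n : ℕ) : defn X n = (Phase.round (some X.owner) n).body := by
  cases X <;> rfl

/-- The player whose win ends the game, read off the two continuations of a flip. -/
def stakeOf : Contract → Contract → Option Player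
  | [.withdraw _], _ => some .A
  | _, [.withdraw _] => some .B
  | _, _ => none

/-- A left inverse of `Phase.body`. -/
def phaseOf : Contract → Option Phase
  | [.withdraw W] => some (.leaf W)
  -- The round `n` is recovered from the argument `n + 1` of the call or from the deadlines `3 * n +
  -- 1` and `3 * n + 2`.
  | [.rngt X k, _] => some (.wait (k - 1) X.owner)
  | [.put _ _ [.put _ _ C, .put _ _ D, _], .after d _] => some (.round (stakeOf C D) ((d - 1) / 3))
  | [.put _ _ C, .put _ _ D, .after d _] => some (.flip (stakeOf C D) ((d - 2) / 3))
  | _ => none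

theorem stakeOf_contBody (L : Option Player) (n : ℕ) :
    stakeOf (contBody L n .A) (contBody L n .B) = L := by
  rcases L with _ | L
  · rfl
  · cases L <;> rfl

@[simp] theorem phaseOf_body (p : Phase) : phaseOf p.body = some p := by
  cases p with
  | round L n => simp [Phase.body, flipBody, phaseOf, stakeOf_contBody]
  | flip L n => simp [Phase.body, flipBody, phaseOf, stakeOf_contBody]
  | wait n W => cases W <;> rfl
  | leaf W => rfl

/-! ### Values -/

/-- The guaranteed share of `P` when the last flip has been won by `W` and round `n` is about to be
renegotiated; rounds from `K` on are counted as worthless. -/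
noncomputable def share (K : ℕ) (P W : Player) (n : ℕ) : ℝ :=
  if W = P then max 0 (4 - 2 ^ (n + 2) / 2 ^ K) else max 0 (2 - 2 ^ (n + 2) / 2 ^ K)

theorem share_nonneg (K : ℕ) (P W : Player) (n : ℕ) : 0 ≤ share K P W n := by
  unfold share; split_ifs <;> exact le_max_left _ _

theorem share_self_le (K : ℕ) (P : Player) (n : ℕ) : share K P P n ≤ 4 := by
  have : (0 : ℝ) ≤ 2 ^ (n + 2) / 2 ^ K := by positivity
  simp only [share, if_true]
  exact max_le (by norm_num) (by linarith)

theorem share_other_le (K : ℕ) {P W : Player} (h : W ≠ P) (n : ℕ) : share K P W n ≤ 2 := by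
  have : (0 : ℝ) ≤ 2 ^ (n + 2) / 2 ^ K := by positivity
  simp only [share, if_neg h]
  exact max_le (by norm_num) (by linarith)

theorem share_le (K : ℕ) (P W : Player) (n : ℕ) : share K P W n ≤ 6 := by
  by_cases h : W = P
  · subst h; linarith [share_self_le K W n]
  · linarith [share_other_le K h n]

/-- The deficit `2 ^ (n + 2) / 2 ^ K` reaches 4, the larger of the two shares, exactly at `n = K`.
-/
theorem share_eq_zero {K n : ℕ} (h : K ≤ n) (P W : Player) : share K P W n = 0 := by
  have : (4 : ℝ) ≤ 2 ^ (n + 2) / 2 ^ K := by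
    rw [le_div_iff₀ (by positivity), pow_add]
    have : (2 : ℝ) ^ K ≤ 2 ^ n := pow_le_pow_right₀ (by norm_num) h
    linarith
  unfold share
  split_ifs <;> exact max_eq_left (by linarith)

/-- The guaranteed share of `P` in round `n`, called by its previous winner `L`, when the flip is
won by `W`. -/
noncomputable def contShare (K : ℕ) (P : Player) (L : Option Player) (n : ℕ) (W : Player) : ℝ :=
  if L = some W then (if W = P ∧ n < K then 6 else 0) else share K P W (n + 1)

theorem contShare_nonneg (K : ℕ) (P : Player) (L : Option Player) (n : ℕ) (W : Player) :
    0 ≤ contShare K P L n W := by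
  unfold contShare; split_ifs
  · norm_num
  · norm_num
  · exact share_nonneg _ _ _ _

theorem contShare_le (K : ℕ) (P : Player) (L : Option Player) (n : ℕ) (W : Player) :
    contShare K P L n W ≤ 6 := by
  unfold contShare; split_ifs
  · norm_num
  · norm_num
  · exact share_le _ _ _ _

theorem contShare_eq_zero {K n : ℕ} (h : K ≤ n) (P : Player) (L : Option Player) (W : Player) :
    contShare K P L n W = 0 := by
  have h' : ¬ (W = P ∧ n < K) := fun h' => absurd h'.2 (by omega)
  simp [contShare, share_eq_zero (show K ≤ n + 1 by omega), h']

theorem share_other_le_self (K : ℕ) {P W : Player} (h : W ≠ P) (n : ℕ) :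
    share K P W n ≤ share K P P n := by
  simp only [share, if_neg h, if_true]
  exact max_le_max le_rfl (by linarith)

/-- Winning is never worse for `P`. An opponent who commits to a secret that makes `P` win with
either bit therefore gains nothing. -/
theorem contShare_other_le (K : ℕ) (P : Player) (L : Option Player) (n : ℕ) :
    contShare K P L n P.other ≤ contShare K P L n P := by
  by_cases h : n < K
  · unfold contShare
    have h1 := share_other_le K P.other_ne (n + 1)
    have h2 := share_other_le_self K P.other_ne (n + 1)
    have h3 := share_nonneg K P P (n + 1)
    have h4 : P.other ≠ P := P.other_ne
    have h5 : share K P P.other (n + 1) ≤ 6 := by linarith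
    simp only [h, and_true, h4, if_false, if_true]
    split_ifs with e e'
    · exact absurd (Option.some.inj (e.symm.trans e')) h4
    · exact h3
    · exact h5
    · exact h2
  · rw [contShare_eq_zero (by omega), contShare_eq_zero (by omega)]

/-- With `x` the deficit of round `n`, the next flip yields 6 or `2 - 2 * x` after a win, and 0 or
`4 - 2 * x` after a loss; the averages are `4 - x` and `2 - x`. Only one of the two outcomes carries
a deficit, so it has to double from round to round. -/
theorem share_le_average (K : ℕ) (P W : Player) (n : ℕ) :
    2 * share K P W n ≤ contShare K P (some W) n P + contShare K P (some W) n P.other := by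
  have key : (2 : ℝ) ^ (n + 1 + 2) / 2 ^ K = 2 * (2 ^ (n + 2) / 2 ^ K) := by ring
  by_cases h : W = P
  · subst h
    by_cases hn : n < K
    · have e : ¬ (some W = some W.other) := by simpa using W.other_ne.symm
      simp only [contShare, share, e, hn, W.other_ne, if_true, if_false, and_true, key]
      generalize (2 : ℝ) ^ (n + 2) / 2 ^ K = x
      rcases le_total 0 (4 - x) with h | h
      · rw [max_eq_right h]; linarith [le_max_right 0 (2 - 2 * x)]
      · rw [max_eq_left h]; linarith [le_max_left 0 (2 - 2 * x)]
    · rw [share_eq_zero (by omega), contShare_eq_zero (by omega), contShare_eq_zero (by omega)]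
      norm_num
  · obtain rfl := Player.eq_other_of_ne h
    have e : ¬ (some P.other = some P) := by simp
    simp only [contShare, share, e, P.other_ne, if_true, if_false, false_and, key]
    generalize (2 : ℝ) ^ (n + 2) / 2 ^ K = x
    rcases le_total 0 (2 - x) with h | h
    · rw [max_eq_right h]; linarith [le_max_right 0 (4 - 2 * x)]
    · rw [max_eq_left h]; linarith [le_max_left 0 (4 - 2 * x)]

/-- The winner of a flip with committed secrets `v`, where `none` is a secret that cannot be
revealed: whoever fails to reveal a valid secret is bound to lose if the other is `P`. -/
def winner : Player → (Player → Option ℕ) → Player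
  | .A, v => if (v .B = some 0 ∨ v .B = some 1) ∧ v .A ≠ v .B then .B else .A
  | .B, v => if v .A = v .B then .A else .B

theorem winner_or (P : Player) (v : Player → Option ℕ) : winner P v = P ∨ winner P v = P.other := by
  cases P <;> simp only [winner] <;> split_ifs <;> simp [Player.other]

/-- No secret of the opponent beats both bits of `P`: a valid one agrees with at most one of them,
and an invalid one loses to both. -/
theorem winner_flip {P : Player} {v w : Player → Option ℕ} {x : Bool}
    (hv : v P = some x.toNat) (hw : w P = some (!x).toNat) (h : w P.other = v P.other) :
    winner P v = P ∨ winner P w = P := by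
  cases P <;> cases x <;> simp_all [winner, Player.other] <;> grind

/-- Of the two bits of `P` at least one wins. If exactly one does, this is `share_le_average`; if
both do, `contShare_other_le` only improves the sum. -/
theorem share_le_winner_average (K : ℕ) {P : Player} (W : Player) (n : ℕ)
    {v w : Player → Option ℕ} {x : Bool}
    (hv : v P = some x.toNat) (hw : w P = some (!x).toNat) (h : w P.other = v P.other) :
    2 * share K P W n ≤
      contShare K P (some W) n (winner P v) + contShare K P (some W) n (winner P w) := by
  have h1 := share_le_average K P W n
  have h2 := contShare_other_le K P (some W) n
  rcases winner_or P v with e | e <;> rcases winner_or P w with e' | e' <;> rw [e, e']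
  · linarith
  · linarith
  · linarith
  · rcases winner_flip hv hw h with e'' | e''
    · exact absurd (e.symm.trans e'') P.other_ne
    · exact absurd (e'.symm.trans e'') P.other_ne

/-- The opening flip has no previous winner, so either outcome leads to shares 4 or 2 of round 1,
each with deficit `8 / 2 ^ K`. -/
theorem start_le_winner_average (K : ℕ) {P : Player}
    {v w : Player → Option ℕ} {x : Bool}
    (hv : v P = some x.toNat) (hw : w P = some (!x).toNat) (h : w P.other = v P.other) :
    6 - 16 / 2 ^ K ≤ contShare K P none 0 (winner P v) + contShare K P none 0 (winner P w) := by
  have h1 : 6 - 16 / 2 ^ K ≤ contShare K P none 0 P + contShare K P none 0 P.other := by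
    simp only [contShare, share, P.other_ne, if_true, if_false, reduceCtorEq]
    have := le_max_right 0 ((4 : ℝ) - 2 ^ (0 + 1 + 2) / 2 ^ K)
    have := le_max_right 0 ((2 : ℝ) - 2 ^ (0 + 1 + 2) / 2 ^ K)
    have e : (16 : ℝ) / 2 ^ K = 2 * (2 ^ (0 + 1 + 2) / 2 ^ K) := by ring
    linarith
  have h2 := contShare_other_le K P none 0
  rcases winner_or P v with e | e <;> rcases winner_or P w with e' | e' <;> rw [e, e']
  · linarith
  · linarith
  · linarith
  · rcases winner_flip hv hw h with e'' | e''
    · exact absurd (e.symm.trans e'') P.other_ne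
    · exact absurd (e'.symm.trans e'') P.other_ne

/-- The number behind a commitment. -/
def Commitment.num : Commitment → Option ℕ
  | .committed N => N
  | .revealed N => some N

def Config.num (c : Config) (s : ℕ) (R : Player) : Option ℕ := (c.secret s R).bind Commitment.num

/-- The guaranteed value for `P` of an active contract, given the committed secrets `v`. -/
noncomputable def value (K : ℕ) (P : Player) (v : ℕ → Player → Option ℕ) (a : Active) : ℝ :=
  match phaseOf a.body with
  | some (.round L n) => contShare K P L n (winner P (v a.session))
  | some (.flip L n) => contShare K P L n (winner P (v a.session))
  | some (.wait n W) => share K P W (n + 1)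
  | some (.leaf W) => if W = P then a.balance else 0
  | none => 0

noncomputable def Config.sum (c : Config) (f : Active → ℝ) : ℝ :=
  ∑ y ∈ Finset.range c.fresh, (c.active y).elim 0 f

/-- The amount received by `P`, plus the guaranteed value of the active contracts. -/
noncomputable def potential (K : ℕ) (P : Player) (c : Config) : ℝ :=
  c.received P + c.sum (value K P c.num)

/-- The amount received by both players, plus the balance of the active contracts. -/
noncomputable def wealth (c : Config) : ℝ :=
  c.received .A + c.received .B + c.sum fun a => a.balance

/-! ### Sums over the active contracts. -/

theorem sum_range_getElem? {α : Type*} (l : List α) (f : α → ℝ) :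
    ∑ i ∈ Finset.range l.length, (l[i]?).elim 0 f = (l.map f).sum := by
  induction l with
  | nil => simp
  | cons a l ih => simp [Finset.sum_range_succ', ih, add_comm]

theorem Config.sum_spawn {c : Config} {x : ℕ} {a : Active} (hx : x < c.fresh)
    (ha : c.active x = some a) (s : ℕ) (parts : List (ℕ × Contract)) (f : Active → ℝ) :
    (c.spawn x s parts).sum f =
      c.sum f - f a + (parts.map fun q => f ⟨q.2, q.1, s⟩).sum := by
  unfold Config.sum
  simp only [Config.spawn]
  rw [Finset.sum_range_add, ← sum_range_getElem?]
  congr 1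
  · rw [← Finset.add_sum_erase _ _ (Finset.mem_range.2 hx),
      ← Finset.add_sum_erase _ _ (Finset.mem_range.2 hx)]
    simp only [if_true, ha, Option.elim]
    rw [zero_add, add_sub_cancel_left]
    refine Finset.sum_congr rfl fun y hy => ?_
    simp only [Finset.mem_erase, Finset.mem_range] at hy
    rw [if_neg hy.1, if_pos hy.2]
  · refine Finset.sum_congr rfl fun i _ => ?_
    rw [if_neg (by omega), if_neg (by omega), Nat.add_sub_cancel_left]
    cases parts[i]? <;> rfl

end BitML

namespace BitML

/-! ### The invariant -/

def Config.Stipulated (c : Config) (s : ℕ) : Prop :=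
  s < c.fresh ∧ c.advert s = none ∧ ∀ Q, c.secret s Q ≠ none

/-- The last time at which, when `P` is rational, a contract in a given phase can be active. -/
def roundSlack : Player → ℕ
  | .A => 1
  | .B => 0

def flipSlack : Player → ℕ
  | .A => 1
  | .B => 2

/-- The time bounds say that `P` acts in time. A withdrawal in favour of `P` is taken as soon as it
opens, at `3 * n + 1` for `A` and `3 * n + 2` for `B`; one against `P` is forestalled one unit
earlier. Stipulation fixes the committed numbers of the session, and a flip is reached only after
`B` has revealed a bit. -/
def Fits (P : Player) (c : Config) (a : Active) : Phase → Prop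
  | .round _ n => a.balance = 6 ∧ c.Stipulated a.session ∧ c.time ≤ 3 * n + roundSlack P
  | .flip _ n => a.balance = 6 ∧ c.Stipulated a.session ∧ c.time ≤ 3 * n + flipSlack P ∧
      ∃ N ≤ 1, c.secret a.session .B = some (.revealed N)
  | .wait n _ => a.balance = 6 ∧ c.time ≤ 3 * n + 3
  | .leaf _ => True

/-- Unused names carry no data, so each session has a coin of its own. `coin` and `pending` say that
before stipulation the secret of `P` is its coin, unrevealed. `parent` identifies the contract that
a stipulation replaces, and `wealth` bounds the potential. -/
structure Inv (P : Player) (coin : ℕ → Bool) (c : Config) : Prop where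
  fresh_pos : 0 < c.fresh
  fresh_active : ∀ y, c.fresh ≤ y → c.active y = none
  fresh_advert : ∀ y, c.fresh ≤ y → c.advert y = none
  fresh_secret : ∀ y R, c.fresh ≤ y → c.secret y R = none
  coin : ∀ s k, c.secret s P = some k → k.num = some (coin s).toNat
  pending : ∀ s R N, c.advert s ≠ none → c.secret s R ≠ some (.revealed N)
  auth : ∀ s d R, c.advert s = some d → d.auth R = true → ∀ Q, c.secret s Q ≠ none
  parent_lt : ∀ s d, c.advert s = some d → d.parent < c.fresh
  parent : ∀ s d a, c.advert s = some d → c.active d.parent = some a →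
    ∃ D ∈ a.body, D.core = .rngt d.var d.arg
  phase : ∀ y a, c.active y = some a → ∃ p : Phase, a.body = p.body ∧ Fits P c a p
  wealth : wealth c = 6

/-- `c'` is a later configuration at the same time. -/
structure Later (c c' : Config) : Prop where
  time : c'.time = c.time
  fresh : c.fresh ≤ c'.fresh
  advert : ∀ s < c.fresh, c.advert s = none → c'.advert s = none
  secret : ∀ s Q, c.secret s Q ≠ none → c'.secret s Q ≠ none
  revealed : ∀ s Q N, c.secret s Q = some (.revealed N) → c'.secret s Q = some (.revealed N)

variable {P : Player} {coin : ℕ → Bool} {c c' : Config}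

theorem Config.Stipulated.mono {s : ℕ} (h : c.Stipulated s) (l : Later c c') : c'.Stipulated s :=
  ⟨h.1.trans_le l.fresh, l.advert s h.1 h.2.1, fun Q => l.secret s Q (h.2.2 Q)⟩

theorem Fits.mono {a : Active} {p : Phase} (h : Fits P c a p) (l : Later c c') : Fits P c' a p := by
  cases p with
  | round L n => exact ⟨h.1, h.2.1.mono l, l.time ▸ h.2.2⟩
  | flip L n =>
    obtain ⟨h1, h2, h3, N, hN, h4⟩ := h
    exact ⟨h1, h2.mono l, l.time ▸ h3, N, hN, l.revealed _ _ _ h4⟩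
  | wait n W => exact ⟨h.1, l.time ▸ h.2⟩
  | leaf W => trivial

theorem Inv.lt_fresh (h : Inv P coin c) {x : ℕ} {a : Active} (ha : c.active x = some a) :
    x < c.fresh := by
  by_contra hx
  rw [h.fresh_active x (by omega)] at ha
  cases ha

/-- The configuration `c.spawn x s parts` with new adverts and new amounts received. -/
def Config.replace (c : Config) (x s : ℕ) (parts : List (ℕ × Contract)) (adv : ℕ → Option Advert)
    (r : Player → ℕ) : Config :=
  { c.spawn x s parts with advert := adv, received := r }

/-! ### Replacing one contract by its successors. -/

section replace

variable {x s : ℕ} {a : Active} {parts : List (ℕ × Contract)} {adv : ℕ → Option Advert}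
  {r : Player → ℕ}

theorem Config.sum_replace (hx : x < c.fresh) (ha : c.active x = some a) (f : Active → ℝ) :
    (c.replace x s parts adv r).sum f =
      c.sum f - f a + (parts.map fun q => f ⟨q.2, q.1, s⟩).sum :=
  Config.sum_spawn hx ha s parts f

theorem potential_replace (K : ℕ) (hx : x < c.fresh) (ha : c.active x = some a) :
    potential K P (c.replace x s parts adv r) = potential K P c +
      (((r P : ℝ) + (parts.map fun q => value K P c.num ⟨q.2, q.1, s⟩).sum) -
        (c.received P + value K P c.num a)) := by
  have := Config.sum_replace (s := s) (parts := parts) (adv := adv) (r := r) hx ha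
    (value K P c.num)
  unfold potential
  change (r P : ℝ) + (c.replace x s parts adv r).sum (value K P c.num) = _
  rw [this]
  ring

theorem later_replace (hadv : ∀ t d, adv t = some d → c.advert t = some d) :
    Later c (c.replace x s parts adv r) where
  time := rfl
  fresh := Nat.le_add_right _ _
  advert t _ h := by
    cases e : adv t with
    | none => exact e
    | some d => rw [hadv t d e] at h; cases h
  secret _ _ h := h
  revealed _ _ _ h := h

/-- Executing a branch and stipulating are both of this form: advertisements can only disappear, and
money is conserved. -/
theorem Inv.replace (h : Inv P coin c) (ha : c.active x = some a)
    (hadv : ∀ t d, adv t = some d → c.advert t = some d)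
    (hparts : ∀ q ∈ parts, ∃ p : Phase, q.2 = p.body ∧
      Fits P (c.replace x s parts adv r) ⟨q.2, q.1, s⟩ p)
    (hr : r .A + r .B + (parts.map Prod.fst).sum = c.received .A + c.received .B + a.balance) :
    Inv P coin (c.replace x s parts adv r) where
  fresh_pos := h.fresh_pos.trans_le (Nat.le_add_right _ _)
  fresh_active y hy := by
    have hy : c.fresh + parts.length ≤ y := hy
    have hx := h.lt_fresh ha
    simp only [Config.replace, Config.spawn]
    rw [if_neg (by omega), if_neg (by omega), List.getElem?_eq_none (by omega)]
    rfl
  fresh_advert y hy := by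
    have hy : c.fresh + parts.length ≤ y := hy
    have e := h.fresh_advert y (by omega)
    change adv y = none
    cases e' : adv y with
    | none => rfl
    | some d => rw [hadv _ _ e'] at e; cases e
  fresh_secret y R hy := by
    have hy : c.fresh + parts.length ≤ y := hy
    exact h.fresh_secret y R (by omega)
  coin := h.coin
  pending t R N ht := by
    refine h.pending t R N fun e => ht ?_
    change adv t = none
    cases e' : adv t with
    | none => rfl
    | some d => rw [hadv _ _ e'] at e; cases e
  auth t d R hd := h.auth t d R (hadv _ _ hd)
  parent_lt t d hd := (h.parent_lt t d (hadv _ _ hd)).trans_le (Nat.le_add_right _ _)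
  parent t d b hd hb := by
    -- Spawned contracts get unused names, so an old advertisement cannot acquire a new parent.
    have hl := h.parent_lt t d (hadv _ _ hd)
    refine h.parent t d b (hadv _ _ hd) ?_
    simp only [Config.replace, Config.spawn] at hb
    split_ifs at hb
    exact hb
  phase y b hb := by
    by_cases hy : y = x
    · simp [Config.replace, Config.spawn, hy] at hb
    by_cases hf : y < c.fresh
    · have hb : c.active y = some b := by
        simpa [Config.replace, Config.spawn, hy, hf] using hb
      obtain ⟨p, hp, hp'⟩ := h.phase y b hb
      exact ⟨p, hp, hp'.mono (later_replace hadv)⟩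
    · have hb : (parts[y - c.fresh]?).map (fun q => (⟨q.2, q.1, s⟩ : Active)) = some b := by
        simpa [Config.replace, Config.spawn, hy, hf] using hb
      rw [Option.map_eq_some_iff] at hb
      obtain ⟨q, hq, rfl⟩ := hb
      exact hparts q (List.mem_of_getElem? hq)
  wealth := by
    have e := h.wealth
    have := Config.sum_replace (s := s) (parts := parts) (adv := adv) (r := r) (h.lt_fresh ha) ha
      (fun a => a.balance)
    unfold BitML.wealth at e ⊢
    rw [this]
    have hr' : (r .A : ℝ) + r .B + ((parts.map Prod.fst).sum : ℕ) =
      c.received .A + c.received .B + a.balance := by exact_mod_cast hr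
    have hs : (((parts.map Prod.fst).sum : ℕ) : ℝ) =
        (parts.map fun q => ((⟨q.2, q.1, s⟩ : Active).balance : ℝ)).sum := by
      simp [Nat.cast_list_sum, List.map_map, Function.comp_def]
    change (r .A : ℝ) + r .B + _ = 6
    linarith

end replace

/-! ### Revealed secrets and executed branches. -/

theorem Config.revealed?_eq_some {s : ℕ} {R : Player} {N : ℕ} :
    c.revealed? s R = some N ↔ c.secret s R = some (.revealed N) := by
  unfold Config.revealed?
  cases h : c.secret s R with
  | none => simp
  | some k => cases k <;> simp

theorem Config.num_revealed {s : ℕ} {R : Player} {N : ℕ}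
    (h : c.secret s R = some (.revealed N)) : c.num s R = some N := by
  simp [Config.num, h, Commitment.num]

theorem bitB_eval {v : Player → ℤ} : bitB.eval v = true ↔ 0 ≤ v .B ∧ v .B ≤ 1 := by
  simp only [bitB, Pred.eval, Bool.and_eq_true, Bool.not_eq_true', decide_eq_false_iff_not, not_lt]
  rfl

theorem sameAB_eval {v : Player → ℤ} : sameAB.eval v = true ↔ v .A = v .B := by
  simp only [sameAB, Pred.eval, Expr.eval]
  exact decide_eq_true_iff

theorem Config.fire_eq_some {x i : ℕ} (h : c.fire x i = some c') :
    ∃ a D, c.active x = some a ∧ a.body[i]? = some D ∧ D.release ≤ c.time ∧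
      ((∃ ss p C, D.core = .put ss p C ∧ (∀ R ∈ ss, (c.revealed? a.session R).isSome) ∧
          p.eval (fun R => (((c.revealed? a.session R).getD 0 : ℕ) : ℤ)) = true ∧
          c' = c.replace x a.session [(a.balance, C)] c.advert c.received) ∨
        (∃ Q, D.core = .withdraw Q ∧ c' = c.replace x a.session [] c.advert
          (Function.update c.received Q (c.received Q + a.balance))) ∨
        (∃ parts, D.core = .split parts ∧ (parts.map Prod.fst).sum = a.balance ∧
          c' = c.replace x a.session parts c.advert c.received)) := by
  unfold Config.fire at h
  split at h
  · cases h
  rename_i a ha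
  split at h
  · cases h
  rename_i D hD
  split_ifs at h with ht
  refine ⟨a, D, ha, hD, ht, ?_⟩
  split at h
  · rename_i ss p C hc
    split_ifs at h with hp
    simp only [Bool.and_eq_true, List.all_eq_true] at hp
    exact Or.inl ⟨ss, p, C, hc, hp.1, hp.2, (Option.some.inj h).symm⟩
  · rename_i Q hc
    exact Or.inr (Or.inl ⟨Q, hc, (Option.some.inj h).symm⟩)
  · rename_i parts hc
    split_ifs at h with hp
    exact Or.inr (Or.inr ⟨parts, hc, hp, (Option.some.inj h).symm⟩)
  · cases h

end BitML

namespace BitML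

variable {P : Player} {coin : ℕ → Bool} {c c' : Config}

/-! ### Values of the phases -/

theorem value_round {K : ℕ} {v : ℕ → Player → Option ℕ} {a : Active} {L : Option Player} {n : ℕ}
    (h : a.body = (Phase.round L n).body) :
    value K P v a = contShare K P L n (winner P (v a.session)) := by
  simp [value, h]

theorem value_flip {K : ℕ} {v : ℕ → Player → Option ℕ} {a : Active} {L : Option Player} {n : ℕ}
    (h : a.body = (Phase.flip L n).body) :
    value K P v a = contShare K P L n (winner P (v a.session)) := by
  simp [value, h]

theorem value_wait {K : ℕ} {v : ℕ → Player → Option ℕ} {a : Active} {n : ℕ} {W : Player}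
    (h : a.body = (Phase.wait n W).body) : value K P v a = share K P W (n + 1) := by
  simp [value, h]

theorem value_leaf {K : ℕ} {v : ℕ → Player → Option ℕ} {a : Active} {W : Player}
    (h : a.body = (Phase.leaf W).body) : value K P v a = if W = P then (a.balance : ℝ) else 0 := by
  simp [value, h]

theorem value_nonneg (K : ℕ) (P : Player) (v : ℕ → Player → Option ℕ) (a : Active) :
    0 ≤ value K P v a := by
  unfold value
  split
  · exact contShare_nonneg _ _ _ _ _
  · exact contShare_nonneg _ _ _ _ _
  · exact share_nonneg _ _ _ _
  · split_ifs <;> positivity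
  · exact le_rfl

theorem Fits.value_le {K : ℕ} {v : ℕ → Player → Option ℕ} {a : Active} {p : Phase}
    (h : Fits P c a p) (hp : a.body = p.body) : value K P v a ≤ a.balance := by
  cases p with
  | round L n =>
    rw [value_round hp, h.1]; exact_mod_cast contShare_le _ _ _ _ _
  | flip L n =>
    rw [value_flip hp, h.1]; exact_mod_cast contShare_le _ _ _ _ _
  | wait n W =>
    rw [value_wait hp, h.1]; exact_mod_cast share_le _ _ _ _
  | leaf W =>
    rw [value_leaf hp]
    split_ifs
    · exact le_rfl
    · positivity

/-- The two versions of `winner` differ only on invalid secrets; on valid ones both agree with the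
test made by the contract. -/
theorem winner_of_valid {v : Player → Option ℕ} {M N : ℕ} (hA : v .A = some M) (hB : v .B = some N)
    (hN : N ≤ 1) : winner P v = if M = N then .A else .B := by
  have hN' : N = 0 ∨ N = 1 := by omega
  cases P <;> simp [winner, hA, hB, hN']

/-- Equality can fail only for a final win of `P` at or beyond the horizon: it is anticipated as 0,
while the resulting leaf counts in full. -/
theorem contShare_le_value {K : ℕ} {v : ℕ → Player → Option ℕ} {L : Option Player} {n : ℕ}
    {W : Player} {s : ℕ} : contShare K P L n W ≤ value K P v ⟨contBody L n W, 6, s⟩ := by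
  unfold contShare
  split_ifs with h1 h2
  · rw [value_leaf (W := W) (by simp [contBody, h1, Phase.body]), if_pos h2.1]
    norm_num
  · exact value_nonneg _ _ _ _
  · rw [value_wait (n := n) (W := W) (by simp [contBody, h1, Phase.body])]

theorem fits_contPhase {a : Active} {L : Option Player} {n : ℕ} {W : Player}
    (h : a.balance = 6) (ht : c.time ≤ 3 * n + 3) : Fits P c a (contPhase L n W) := by
  unfold contPhase
  split_ifs
  · trivial
  · exact ⟨h, ht⟩

/-! ### Firing a branch -/

theorem Inv.fire_put (h : Inv P coin c) {x : ℕ} {a : Active} (ha : c.active x = some a)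
    {C : Contract} {p : Phase} (hC : C = p.body)
    (hp : Fits P c ⟨C, a.balance, a.session⟩ p)
    (hv : ∀ K, value K P c.num a ≤ value K P c.num ⟨C, a.balance, a.session⟩) :
    Inv P coin (c.replace x a.session [(a.balance, C)] c.advert c.received) ∧
      ∀ K, potential K P c ≤
        potential K P (c.replace x a.session [(a.balance, C)] c.advert c.received) := by
  constructor
  · refine h.replace ha (fun _ _ h => h) ?_ (by simp)
    intro q hq
    rw [List.mem_singleton] at hq
    subst hq
    exact ⟨p, hC, hp.mono (later_replace fun _ _ h => h)⟩
  · intro K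
    rw [potential_replace K (h.lt_fresh ha) ha]
    have := hv K
    simp only [List.map_cons, List.map_nil, List.sum_cons, List.sum_nil]
    linarith

/-- A withdrawal by `P` pays the whole balance, which bounds the value. A withdrawal by the opponent
is harmless only from a contract worth nothing to `P`. -/
theorem Inv.fire_withdraw (h : Inv P coin c) {x : ℕ} {a : Active} (ha : c.active x = some a)
    {Q : Player} (hv : Q ≠ P → ∀ K, value K P c.num a = 0) :
    Inv P coin (c.replace x a.session [] c.advert
        (Function.update c.received Q (c.received Q + a.balance))) ∧
      ∀ K, potential K P c ≤ potential K P (c.replace x a.session [] c.advert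
        (Function.update c.received Q (c.received Q + a.balance))) := by
  constructor
  · refine h.replace ha (fun _ _ h => h) (by simp) ?_
    cases Q <;> simp [Function.update_of_ne] <;> omega
  · intro K
    rw [potential_replace K (h.lt_fresh ha) ha]
    simp only [List.map_nil, List.sum_nil]
    by_cases hQ : Q = P
    · subst hQ
      obtain ⟨p, hp, hp'⟩ := h.phase x a ha
      have := hp'.value_le (K := K) (v := c.num) hp
      rw [Function.update_self]
      push_cast
      linarith
    · rw [Function.update_of_ne (Ne.symm hQ), hv hQ K]
      linarith

theorem Inv.fire_round (h : Inv P coin c) {x : ℕ} {a : Active} (ha : c.active x = some a)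
    {L : Option Player} {n : ℕ} (hb : a.body = (Phase.round L n).body)
    (hf : Fits P c a (.round L n)) {i : ℕ} (hi : c.fire x i = some c') :
    Inv P coin c' ∧ ∀ K, potential K P c ≤ potential K P c' := by
  obtain ⟨a', D, ha', hD, ht, hcases⟩ := Config.fire_eq_some hi
  obtain rfl : a = a' := Option.some.inj (ha.symm.trans ha')
  have hm := List.mem_of_getElem? hD
  obtain ⟨hbal, hst, htime⟩ := hf
  simp only [hb, Phase.body, List.mem_cons, List.not_mem_nil, or_false] at hm
  rcases hm with rfl | rfl
  · simp only [Guarded.core, Guarded.put.injEq, reduceCtorEq, false_and, exists_false, or_false]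
      at hcases
    obtain ⟨ss, p, C, ⟨rfl, rfl, rfl⟩, hrev, hev, rfl⟩ := hcases
    have hrev := hrev .B (by simp)
    rw [Option.isSome_iff_exists] at hrev
    obtain ⟨N, hN⟩ := hrev
    rw [bitB_eval, hN] at hev
    have hN1 : N ≤ 1 := by exact_mod_cast hev.2
    refine h.fire_put ha (p := .flip L n) rfl ⟨hbal, hst, ?_, N, hN1,
      Config.revealed?_eq_some.1 hN⟩ ?_
    · exact htime.trans (by cases P <;> simp [roundSlack, flipSlack])
    · intro K
      rw [value_round hb, value_flip (a := ⟨flipBody L n, a.balance, a.session⟩) rfl]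
  · simp only [Guarded.core, Guarded.withdraw.injEq, reduceCtorEq, false_and, exists_false,
      false_or, or_false] at hcases
    obtain ⟨Q, rfl, rfl⟩ := hcases
    -- Against `B` this withdrawal opens at `3 * n + 1`, but the round is active only up to time `3
    -- * n`.
    refine h.fire_withdraw ha fun hQ => ?_
    cases P with
    | A => exact absurd rfl hQ
    | B =>
      simp only [Guarded.release, roundSlack] at ht htime
      omega

theorem Inv.fire_flip (h : Inv P coin c) {x : ℕ} {a : Active} (ha : c.active x = some a)
    {L : Option Player} {n : ℕ} (hb : a.body = (Phase.flip L n).body)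
    (hf : Fits P c a (.flip L n)) {i : ℕ} (hi : c.fire x i = some c') :
    Inv P coin c' ∧ ∀ K, potential K P c ≤ potential K P c' := by
  obtain ⟨a', D, ha', hD, ht, hcases⟩ := Config.fire_eq_some hi
  obtain rfl : a = a' := Option.some.inj (ha.symm.trans ha')
  have hm := List.mem_of_getElem? hD
  obtain ⟨hbal, hst, htime, N, hN, hrevB⟩ := hf
  have htime' : c.time ≤ 3 * n + 3 :=
    htime.trans (by cases P <;> simp [flipSlack])
  have hput : ∀ W C, C = contBody L n W → winner P (c.num a.session) = W →
      c' = c.replace x a.session [(a.balance, C)] c.advert c.received →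
      Inv P coin c' ∧ ∀ K, potential K P c ≤ potential K P c' := by
    rintro W C rfl hW rfl
    refine h.fire_put ha (p := contPhase L n W) (body_contPhase _ _ _).symm
      (fits_contPhase hbal htime') ?_
    intro K
    rw [value_flip hb, hW, hbal]
    exact contShare_le_value
  simp only [hb, Phase.body, flipBody, List.mem_cons, List.not_mem_nil, or_false] at hm
  rcases hm with rfl | rfl | rfl
  · simp only [Guarded.core, Guarded.put.injEq, reduceCtorEq, false_and, exists_false, or_false]
      at hcases
    obtain ⟨ss, p, C, ⟨rfl, rfl, hC⟩, hrev, hev, hc'⟩ := hcases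
    have hrev := hrev .A (by simp)
    rw [Option.isSome_iff_exists] at hrev
    obtain ⟨M, hM⟩ := hrev
    rw [sameAB_eval, hM, Config.revealed?_eq_some.2 hrevB] at hev
    have hMN : M = N := by exact_mod_cast hev
    refine hput .A C hC.symm ?_ hc'
    rw [winner_of_valid (Config.num_revealed (Config.revealed?_eq_some.1 hM))
      (Config.num_revealed hrevB) hN, if_pos hMN]
  · simp only [Guarded.core, Guarded.put.injEq, reduceCtorEq, false_and, exists_false, or_false]
      at hcases
    obtain ⟨ss, p, C, ⟨rfl, rfl, hC⟩, hrev, hev, hc'⟩ := hcases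
    have hrev := hrev .A (by simp)
    rw [Option.isSome_iff_exists] at hrev
    obtain ⟨M, hM⟩ := hrev
    rw [Pred.eval, Bool.not_eq_true', ← Bool.not_eq_true, sameAB_eval, hM,
      Config.revealed?_eq_some.2 hrevB] at hev
    have hMN : ¬ M = N := fun e => hev (by rw [e])
    refine hput .B C hC.symm ?_ hc'
    rw [winner_of_valid (Config.num_revealed (Config.revealed?_eq_some.1 hM))
      (Config.num_revealed hrevB) hN, if_neg hMN]
  · simp only [Guarded.core, Guarded.withdraw.injEq, reduceCtorEq, false_and, exists_false,
      false_or, or_false] at hcases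
    obtain ⟨Q, rfl, rfl⟩ := hcases
    -- Against `A` this withdrawal opens at `3 * n + 2`, but the flip is active only up to time `3 *
    -- n + 1`.
    refine h.fire_withdraw ha fun hQ => ?_
    cases P with
    | B => exact absurd rfl hQ
    | A =>
      simp only [Guarded.release, flipSlack] at ht htime
      omega

/-- The split pays 4 and 2, the shares without deficit. -/
theorem Inv.fire_wait (h : Inv P coin c) {x : ℕ} {a : Active} (ha : c.active x = some a)
    {n : ℕ} {W : Player} (hb : a.body = (Phase.wait n W).body)
    {i : ℕ} (hi : c.fire x i = some c') :
    Inv P coin c' ∧ ∀ K, potential K P c ≤ potential K P c' := by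
  obtain ⟨a', D, ha', hD, ht, hcases⟩ := Config.fire_eq_some hi
  obtain rfl : a = a' := Option.some.inj (ha.symm.trans ha')
  have hm := List.mem_of_getElem? hD
  simp only [hb, Phase.body, List.mem_cons, List.not_mem_nil, or_false] at hm
  rcases hm with rfl | rfl
  · simp [Guarded.core] at hcases
  · simp only [Guarded.core, splitFor, Guarded.split.injEq, reduceCtorEq, false_and, exists_false,
      false_or] at hcases
    obtain ⟨parts, rfl, hsum, rfl⟩ := hcases
    constructor
    · refine h.replace ha (fun _ _ h => h) ?_ (by rw [hsum])
      intro q hq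
      simp only [List.mem_cons, List.not_mem_nil, or_false] at hq
      rcases hq with rfl | rfl
      · exact ⟨.leaf W, rfl, trivial⟩
      · exact ⟨.leaf W.other, rfl, trivial⟩
    · intro K
      rw [potential_replace K (h.lt_fresh ha) ha, value_wait hb]
      simp only [List.map_cons, List.map_nil, List.sum_cons, List.sum_nil]
      rw [value_leaf (W := W) rfl, value_leaf (W := W.other) rfl]
      by_cases hW : W = P
      · subst hW
        have := share_self_le K W (n + 1)
        simp only [if_true, W.other_ne, if_false]
        push_cast
        linarith
      · have := share_other_le K hW (n + 1)
        obtain rfl := Player.eq_other_of_ne hW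
        simp only [P.other_ne, P.other_other, if_true, if_false]
        push_cast
        linarith

theorem Inv.fire_leaf (h : Inv P coin c) {x : ℕ} {a : Active} (ha : c.active x = some a)
    {W : Player} (hb : a.body = (Phase.leaf W).body)
    {i : ℕ} (hi : c.fire x i = some c') :
    Inv P coin c' ∧ ∀ K, potential K P c ≤ potential K P c' := by
  obtain ⟨a', D, ha', hD, ht, hcases⟩ := Config.fire_eq_some hi
  obtain rfl : a = a' := Option.some.inj (ha.symm.trans ha')
  have hm := List.mem_of_getElem? hD
  simp only [hb, Phase.body, List.mem_cons, List.not_mem_nil, or_false] at hm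
  subst hm
  simp only [Guarded.core, Guarded.withdraw.injEq, reduceCtorEq, false_and, exists_false,
    false_or, or_false] at hcases
  obtain ⟨Q, rfl, rfl⟩ := hcases
  refine h.fire_withdraw ha fun hQ K => ?_
  rw [value_leaf hb, if_neg hQ]

theorem Inv.fire (h : Inv P coin c) {x i : ℕ} (hi : c.fire x i = some c') :
    Inv P coin c' ∧ ∀ K, potential K P c ≤ potential K P c' := by
  obtain ⟨a, -, ha, -⟩ := Config.fire_eq_some hi
  obtain ⟨p, hb, hf⟩ := h.phase x a ha
  cases p with
  | round L n => exact h.fire_round ha hb hf hi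
  | flip L n => exact h.fire_flip ha hb hf hi
  | wait n W => exact h.fire_wait ha hb hi
  | leaf W => exact h.fire_leaf ha hb hi

end BitML

namespace BitML

variable {P : Player} {coin : ℕ → Bool} {c c' : Config}

/-! ### Moves that do not replace a contract -/

theorem Fits.value_congr {K : ℕ} {v w : ℕ → Player → Option ℕ} {a : Active} {p : Phase}
    (h : Fits P c a p) (hp : a.body = p.body) (hvw : ∀ s, c.Stipulated s → w s = v s) :
    value K P w a = value K P v a := by
  cases p with
  | round L n => rw [value_round hp, value_round hp, hvw _ h.2.1]
  | flip L n => rw [value_flip hp, value_flip hp, hvw _ h.2.1]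
  | wait n W => rw [value_wait hp, value_wait hp]
  | leaf W => rw [value_leaf hp, value_leaf hp]

/-- Values depend only on secrets of stipulated sessions, so commitments to pending ones do not
matter. -/
theorem Inv.potential_congr (h : Inv P coin c) (K : ℕ) (hact : c'.active = c.active)
    (hfresh : c'.fresh = c.fresh) (hrec : c'.received = c.received)
    (hnum : ∀ s, c.Stipulated s → c'.num s = c.num s) : potential K P c' = potential K P c := by
  unfold potential Config.sum
  rw [hact, hfresh, hrec]
  congr 1
  refine Finset.sum_congr rfl fun y _ => ?_
  cases hy : c.active y with
  | none => rfl
  | some a =>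
    obtain ⟨p, hp, hf⟩ := h.phase y a hy
    exact hf.value_congr hp hnum

theorem Config.setSecret_secret {s t : ℕ} {R Q : Player} {k : Commitment} :
    (c.setSecret s R k).secret t Q = if t = s ∧ Q = R then some k else c.secret t Q := by
  simp only [Config.setSecret, Function.update_apply]
  by_cases ht : t = s
  · subst ht; simp [Function.update_apply]
  · simp [ht]

theorem Inv.setSecret (h : Inv P coin c) {s : ℕ} {R : Player} {k : Commitment}
    (hs : s < c.fresh) (hcoin : R = P → k.num = some (coin s).toNat)
    (hpend : c.advert s ≠ none → ∀ N, k ≠ .revealed N)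
    (hrev : ∀ N, c.secret s R ≠ some (.revealed N)) : Inv P coin (c.setSecret s R k) := by
  have hne : ∀ t Q, c.secret t Q ≠ none → (c.setSecret s R k).secret t Q ≠ none := by
    intro t Q ht
    rw [Config.setSecret_secret]
    split_ifs
    · simp
    · exact ht
  have hl : Later c (c.setSecret s R k) := by
    refine ⟨rfl, le_rfl, fun _ _ h => h, hne, fun t Q N ht => ?_⟩
    rw [Config.setSecret_secret]
    split_ifs with e
    · obtain ⟨rfl, rfl⟩ := e; exact absurd ht (hrev N)
    · exact ht
  refine ⟨h.fresh_pos, h.fresh_active, h.fresh_advert, ?_, ?_, ?_, ?_, h.parent_lt, h.parent, ?_,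
    h.wealth⟩
  · intro y Q hy
    have hy : c.fresh ≤ y := hy
    rw [Config.setSecret_secret, if_neg (fun e => by omega)]
    exact h.fresh_secret y Q hy
  · intro t k' ht
    rw [Config.setSecret_secret] at ht
    split_ifs at ht with e
    · obtain ⟨rfl, rfl⟩ := e
      rw [← Option.some.inj ht]
      exact hcoin rfl
    · exact h.coin t k' ht
  · intro t Q N ht hk
    rw [Config.setSecret_secret] at hk
    split_ifs at hk with e
    · obtain ⟨rfl, rfl⟩ := e
      exact hpend ht N (Option.some.inj hk)
    · exact h.pending t Q N ht hk
  · intro t d Q hd hQ Q'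
    exact hne t Q' (h.auth t d Q hd hQ Q')
  · intro y a hy
    obtain ⟨p, hp, hf⟩ := h.phase y a hy
    exact ⟨p, hp, hf.mono hl⟩

theorem Inv.commit (h : Inv P coin c) {R : Player} {s : ℕ} {N : Option ℕ}
    (hN : R = P → N = some (coin s).toNat) (hi : c.step (.commit R s) N = some c') :
    Inv P coin c' ∧ ∀ K, potential K P c' = potential K P c := by
  simp only [Config.step] at hi
  split at hi
  swap
  · cases hi
  rename_i d hd hs
  obtain rfl := Option.some.inj hi
  constructor
  · refine h.setSecret ?_ hN (by simp) (by simp [hs])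
    by_contra hlt
    rw [h.fresh_advert s (by omega)] at hd
    cases hd
  · intro K
    refine h.potential_congr K rfl rfl rfl fun t ht => ?_
    funext Q
    have : t ≠ s := by
      rintro rfl
      rw [ht.2.1] at hd
      cases hd
    simp [Config.num, Config.setSecret_secret, this]

theorem Inv.reveal (h : Inv P coin c) {R : Player} {s : ℕ} {N : Option ℕ}
    (hi : c.step (.reveal R s) N = some c') :
    Inv P coin c' ∧ ∀ K, potential K P c' = potential K P c := by
  simp only [Config.step] at hi
  split at hi
  swap
  · cases hi
  rename_i M hd hs
  obtain rfl := Option.some.inj hi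
  constructor
  · refine h.setSecret ?_ ?_ (fun e => absurd hd e) (by simp [hs])
    · by_contra hlt
      rw [h.fresh_secret s R (by omega)] at hs
      cases hs
    · rintro rfl
      exact h.coin s (.committed (some M)) hs
  · intro K
    refine h.potential_congr K rfl rfl rfl fun t ht => ?_
    funext Q
    simp only [Config.num, Config.setSecret_secret]
    split_ifs with e
    · obtain ⟨rfl, rfl⟩ := e
      rw [hs]
      rfl
    · rfl

theorem Inv.authorize (h : Inv P coin c) {R : Player} {s : ℕ} {N : Option ℕ}
    (hi : c.step (.authorize R s) N = some c') :
    Inv P coin c' ∧ ∀ K, potential K P c' = potential K P c := by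
  simp only [Config.step] at hi
  split at hi
  swap
  · cases hi
  rename_i d kA kB hd hA hB
  obtain rfl := Option.some.inj hi
  have hs : s < c.fresh := by
    by_contra hlt
    rw [h.fresh_advert s (by omega)] at hd
    cases hd
  refine ⟨⟨h.fresh_pos, h.fresh_active, ?_, h.fresh_secret, h.coin, ?_, ?_, ?_, ?_, ?_, h.wealth⟩,
    fun K => h.potential_congr K rfl rfl rfl fun _ _ => rfl⟩
  · intro y hy
    have hy : c.fresh ≤ y := hy
    simp only [Function.update_apply]
    rw [if_neg (by omega)]
    exact h.fresh_advert y hy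
  · intro t Q M ht
    by_cases e : t = s
    · subst e; exact h.pending t Q M (by simp [hd])
    · exact h.pending t Q M (by simpa [Function.update_apply, e] using ht)
  · intro t d' Q hd' hQ Q'
    by_cases e : t = s
    · subst e
      cases Q' <;> simp [hA, hB]
    · exact h.auth t d' Q (by simpa [Function.update_apply, e] using hd') hQ Q'
  · intro t d' hd'
    by_cases e : t = s
    · subst e
      simp only [Function.update_self, Option.some.injEq] at hd'
      subst hd'
      exact h.parent_lt t d hd
    · exact h.parent_lt t d' (by simpa [Function.update_apply, e] using hd')
  · intro t d' a hd' ha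
    by_cases e : t = s
    · subst e
      simp only [Function.update_self, Option.some.injEq] at hd'
      subst hd'
      exact h.parent t d a hd ha
    · exact h.parent t d' a (by simpa [Function.update_apply, e] using hd') ha
  · intro y a ha
    obtain ⟨p, hp, hf⟩ := h.phase y a ha
    refine ⟨p, hp, hf.mono ⟨rfl, le_rfl, fun t _ ht => ?_, fun _ _ h => h, fun _ _ _ h => h⟩⟩
    have e : t ≠ s := by
      rintro rfl
      rw [ht] at hd; cases hd
    simpa [Function.update_apply, e] using ht

theorem Config.advertise_eq_some {x i : ℕ} (h : c.advertise x i = some c') :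
    ∃ a D X k, c.active x = some a ∧ D ∈ a.body ∧ D.core = .rngt X k ∧
      c' = { c with
        advert := Function.update c.advert c.fresh (some ⟨x, X, k, fun _ => false⟩)
        fresh := c.fresh + 1 } := by
  unfold Config.advertise at h
  split at h
  · cases h
  rename_i a ha
  split at h
  · cases h
  rename_i D hD
  split_ifs at h
  split at h
  · rename_i X k hc
    split_ifs at h
    exact ⟨a, D, X, k, ha, List.mem_of_getElem? hD, hc, (Option.some.inj h).symm⟩
  · cases h

theorem Inv.advertise (h : Inv P coin c) {x i : ℕ} (hi : c.advertise x i = some c') :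
    Inv P coin c' ∧ ∀ K, potential K P c' = potential K P c := by
  obtain ⟨a, D, X, k, ha, hD, hc, rfl⟩ := Config.advertise_eq_some hi
  -- The new name belongs to an advertisement and contributes no contract to the sums.
  have hsum : ∀ f : Active → ℝ, ∑ y ∈ Finset.range (c.fresh + 1), (c.active y).elim 0 f =
      ∑ y ∈ Finset.range c.fresh, (c.active y).elim 0 f := by
    intro f
    rw [Finset.sum_range_succ, h.fresh_active _ le_rfl]
    simp
  have hfr := h.fresh_advert _ le_rfl
  refine ⟨⟨Nat.succ_pos _, ?_, ?_, ?_, h.coin, ?_, ?_, ?_, ?_, ?_, ?_⟩, ?_⟩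
  · exact fun y hy => h.fresh_active y (Nat.le_of_succ_le hy)
  · intro y hy
    have hy : c.fresh + 1 ≤ y := hy
    simp only [Function.update_apply]
    rw [if_neg (by omega)]
    exact h.fresh_advert y (by omega)
  · exact fun y R hy => h.fresh_secret y R (Nat.le_of_succ_le hy)
  · intro t Q N ht hk
    by_cases e : t = c.fresh
    · subst e
      rw [show c.secret c.fresh Q = none from h.fresh_secret _ _ le_rfl] at hk
      cases hk
    · exact h.pending t Q N (by simpa [Function.update_apply, e] using ht) hk
  · intro t d Q hd hQ Q'
    by_cases e : t = c.fresh
    · subst e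
      simp only [Function.update_self, Option.some.injEq] at hd
      subst hd
      cases hQ
    · exact h.auth t d Q (by simpa [Function.update_apply, e] using hd) hQ Q'
  · intro t d hd
    by_cases e : t = c.fresh
    · subst e
      simp only [Function.update_self, Option.some.injEq] at hd
      subst hd
      exact (h.lt_fresh ha).trans (Nat.lt_succ_self _)
    · exact (h.parent_lt t d (by simpa [Function.update_apply, e] using hd)).trans
        (Nat.lt_succ_self _)
  · intro t d b hd hb
    by_cases e : t = c.fresh
    · subst e
      simp only [Function.update_self, Option.some.injEq] at hd
      subst hd
      obtain rfl := Option.some.inj (ha.symm.trans hb)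
      exact ⟨D, hD, hc⟩
    · exact h.parent t d b (by simpa [Function.update_apply, e] using hd) hb
  · intro y b hb
    obtain ⟨p, hp, hf⟩ := h.phase y b hb
    refine ⟨p, hp, hf.mono ⟨rfl, Nat.le_succ _, fun t hlt ht => ?_, fun _ _ h => h,
      fun _ _ _ h => h⟩⟩
    simpa [Function.update_apply, hlt.ne] using ht
  · have e := h.wealth
    unfold BitML.wealth Config.sum at e ⊢
    rw [hsum]
    exact e
  · intro K
    unfold potential Config.sum
    rw [hsum]
    rfl

/-! ### Stipulation -/

/-- The number of a committed bit is replaced by the other bit. -/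
def Commitment.swap : Commitment → Commitment
  | .committed N => .committed (N.map (1 - ·))
  | .revealed N => .revealed N

/-- The configuration in which the unrevealed bit of `P` in session `s` is flipped. -/
def Config.swap (c : Config) (s : ℕ) (P : Player) : Config :=
  { c with
    secret := fun t R => if t = s ∧ R = P then (c.secret t R).map Commitment.swap
      else c.secret t R }

theorem Config.init_eq_some {s : ℕ} (h : c.init s = some c') :
    ∃ d a, c.advert s = some d ∧ c.active d.parent = some a ∧ d.auth .A = true ∧
      c' = c.replace d.parent s [(a.balance, defn d.var d.arg)] (Function.update c.advert s none)
        c.received := by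
  unfold Config.init at h
  split at h
  · cases h
  rename_i d hd
  split at h
  · cases h
  rename_i a ha
  split_ifs at h with hau
  rw [Bool.and_eq_true] at hau
  exact ⟨d, a, hd, ha, hau.1, (Option.some.inj h).symm⟩

theorem RecVar.owner_recVar (W : Player) : W.recVar.owner = W := by cases W <;> rfl

/-- Among the phases only `wait` has a renegotiation branch, and that branch calls the next round
for the last winner. -/
theorem Inv.exists_wait (h : Inv P coin c) {s : ℕ} {d : Advert} {a : Active}
    (hd : c.advert s = some d) (ha : c.active d.parent = some a) :
    ∃ n W, a.body = (Phase.wait n W).body ∧ Fits P c a (.wait n W) ∧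
      defn d.var d.arg = (Phase.round (some W) (n + 1)).body := by
  obtain ⟨D, hD, hc⟩ := h.parent s d a hd ha
  obtain ⟨p, hp, hf⟩ := h.phase _ a ha
  rw [hp] at hD
  cases p with
  | round L n =>
    simp only [Phase.body, List.mem_cons, List.not_mem_nil, or_false] at hD
    rcases hD with rfl | rfl <;> simp [Guarded.core] at hc
  | flip L n =>
    simp only [Phase.body, flipBody, List.mem_cons, List.not_mem_nil, or_false] at hD
    rcases hD with rfl | rfl | rfl <;> simp [Guarded.core] at hc
  | wait n W =>
    refine ⟨n, W, hp, hf, ?_⟩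
    simp only [Phase.body, List.mem_cons, List.not_mem_nil, or_false] at hD
    rcases hD with rfl | rfl
    · simp only [Guarded.core, Guarded.rngt.injEq] at hc
      rw [← hc.1, ← hc.2, defn_eq, RecVar.owner_recVar]
    · simp [Guarded.core, splitFor] at hc
  | leaf W =>
    simp only [Phase.body, List.mem_cons, List.not_mem_nil, or_false] at hD
    subst hD
    simp [Guarded.core] at hc

theorem Inv.init (h : Inv P coin c) {s : ℕ} (hi : c.init s = some c') : Inv P coin c' := by
  obtain ⟨d, a, hd, ha, hau, rfl⟩ := Config.init_eq_some hi
  obtain ⟨n, W, hb, hf, hdef⟩ := h.exists_wait hd ha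
  have hs : s < c.fresh := by
    by_contra hlt
    rw [h.fresh_advert s (by omega)] at hd
    cases hd
  refine h.replace ha ?_ ?_ (by simp)
  · intro t e he
    by_cases hts : t = s
    · simp [hts] at he
    · simpa [Function.update_apply, hts] using he
  · intro q hq
    rw [List.mem_singleton] at hq
    subst hq
    refine ⟨_, hdef, hf.1, ⟨hs.trans_le (Nat.le_add_right _ _), Function.update_self ..,
      h.auth s d .A hd hau⟩, ?_⟩
    -- The new round starts no later than `3 * n + 3 = 3 * (n + 1)`, which meets its deadline even
    -- with slack 0.
    · have : c.time ≤ 3 * n + 3 := hf.2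
      change c.time ≤ 3 * (n + 1) + roundSlack P
      omega

/-- A `wait` phase of round `n` that is still active after time `3 * K` has `3 * K < 3 * n + 3`, so
its share is already counted as 0 and nothing can be lost. -/
theorem Inv.init_late (h : Inv P coin c) {s : ℕ} (hi : c.init s = some c') {K : ℕ}
    (hK : 3 * K < c.time) : potential K P c ≤ potential K P c' := by
  obtain ⟨d, a, hd, ha, hau, rfl⟩ := Config.init_eq_some hi
  obtain ⟨n, W, hb, hf, hdef⟩ := h.exists_wait hd ha
  have : c.time ≤ 3 * n + 3 := hf.2
  rw [potential_replace K (h.lt_fresh ha) ha, value_wait hb, share_eq_zero (by omega)]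
  simp only [List.map_cons, List.map_nil, List.sum_cons, List.sum_nil]
  have := value_nonneg K P c.num ⟨defn d.var d.arg, a.balance, s⟩
  linarith

/-- Before the stipulation the potential does not involve the pending bit; after it, the two bits
give the two sides of `share_le_winner_average`. -/
theorem Inv.init_average (h : Inv P coin c) {s : ℕ} (hi : c.init s = some c') (K : ℕ) :
    2 * potential K P c ≤ potential K P c' + potential K P (c'.swap s P) := by
  obtain ⟨d, a, hd, ha, hau, rfl⟩ := Config.init_eq_some hi
  obtain ⟨n, W, hb, hf, hdef⟩ := h.exists_wait hd ha
  have hswap : potential K P (c.swap s P) = potential K P c := by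
    refine h.potential_congr K rfl rfl rfl fun t ht => ?_
    have : t ≠ s := by
      rintro rfl
      rw [ht.2.1] at hd
      cases hd
    funext Q
    simp [Config.num, Config.swap, this]
  -- Swapping the secret commutes with replacing the contract, by definition.
  change _ ≤ _ + potential K P ((c.swap s P).replace d.parent s [(a.balance, defn d.var d.arg)]
    (Function.update c.advert s none) c.received)
  rw [potential_replace K (h.lt_fresh ha) ha, potential_replace K (c := c.swap s P)
    (h.lt_fresh ha) ha, hswap, value_wait hb, value_wait hb]
  simp only [List.map_cons, List.map_nil, List.sum_cons, List.sum_nil]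
  rw [value_round (a := ⟨defn d.var d.arg, a.balance, s⟩) hdef,
    value_round (a := ⟨defn d.var d.arg, a.balance, s⟩) hdef]
  have hnum : c.num s P = some (coin s).toNat ∧ (c.swap s P).num s P = some (!coin s).toNat := by
    cases hk : c.secret s P with
    | none => exact absurd hk (h.auth s d .A hd hau P)
    | some k =>
      have hc := h.coin s k hk
      cases k with
      | revealed N => exact absurd hk (h.pending s P N (by simp [hd]))
      | committed N =>
        have hN : N = some (coin s).toNat := hc
        subst hN
        simp only [Config.num, Config.swap, hk]
        constructor
        · rfl
        · cases coin s <;> rfl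
  have := share_le_winner_average K (P := P) W (n + 1) hnum.1 hnum.2
    (by simp [Config.num, Config.swap])
  have e : (c.swap s P).received = c.received := rfl
  rw [e]
  linarith

end BitML

namespace BitML

variable {P : Player} {coin : ℕ → Bool} {c c' : Config}

/-! ### The passing of time -/

/-- Rationality speaks of the configuration as `P` sees it; since hiding leaves revealed secrets
alone, a `put` is executable there exactly when it really is. -/
theorem revealed?_ownView (s : ℕ) (R : Player) :
    (c.ownView P).revealed? s R = c.revealed? s R := by
  unfold Config.revealed? Config.ownView Config.hide
  cases h : c.secret s R with
  | none => simp [h]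
  | some k => cases k <;> simp [h]

/-! ### Moves that are due before time passes. -/

section enabled

variable {x i : ℕ} {a : Active} {D : Guarded}

theorem fire_put_isSome {ss : List Player} {p : Pred} {C : Contract} (ha : c.active x = some a)
    (hD : a.body[i]? = some D) (ht : D.release ≤ c.time) (hc : D.core = .put ss p C)
    (hrev : ∀ R ∈ ss, (c.revealed? a.session R).isSome)
    (hev : p.eval (fun R => (((c.revealed? a.session R).getD 0 : ℕ) : ℤ)) = true) :
    (c.fire x i).isSome := by
  have : (ss.all fun R => (c.revealed? a.session R).isSome) = true := by simpa using hrev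
  simp [Config.fire, ha, hD, ht, hc, this, hev]

theorem fire_withdraw_isSome {Q : Player} (ha : c.active x = some a)
    (hD : a.body[i]? = some D) (ht : D.release ≤ c.time) (hc : D.core = .withdraw Q) :
    (c.fire x i).isSome := by
  simp [Config.fire, ha, hD, ht, hc]

theorem fire_split_isSome {parts : List (ℕ × Contract)} (ha : c.active x = some a)
    (hD : a.body[i]? = some D) (ht : D.release ≤ c.time) (hc : D.core = .split parts)
    (hs : (parts.map Prod.fst).sum = a.balance) :
    (c.fire x i).isSome := by
  simp [Config.fire, ha, hD, ht, hc, hs]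

/-- When `P` lets time pass, no withdrawal in favour of `P` is executable. -/
theorem time_lt_of_withdraw (hdue : ∀ m, ¬ Due P (c.ownView P) m) (ha : c.active x = some a)
    (hD : a.body[i]? = some D) (hc : D.core = .withdraw P) : c.time < D.release := by
  by_contra ht
  exact hdue _ (.withdraw (c := c.ownView P) ha hD hc
    (fire_withdraw_isSome (c := c.ownView P) ha hD (not_lt.1 ht) hc))

theorem time_lt_of_split (hdue : ∀ m, ¬ Due P (c.ownView P) m) {parts : List (ℕ × Contract)}
    (ha : c.active x = some a) (hD : a.body[i]? = some D) (hc : D.core = .split parts)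
    (hs : (parts.map Prod.fst).sum = a.balance) : c.time < D.release := by
  by_contra ht
  exact hdue _ (.split (c := c.ownView P) ha hD hc
    (fire_split_isSome (c := c.ownView P) ha hD (not_lt.1 ht) hc hs))

/-- When `P` lets time pass under a threat, the secret of `P` has been revealed. -/
theorem revealed_of_threat (h : Inv P coin c) (hdue : ∀ m, ¬ Due P (c.ownView P) m)
    {ss : List Player} {p : Pred} {C : Contract}
    (ha : c.active x = some a) (hD : a.body[i]? = some D) (hc : D.core = .put ss p C)
    (hP : P ∈ ss) (hst : c.Stipulated a.session) (ht : Threat P c a) :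
    c.secret a.session P = some (.revealed (coin a.session).toNat) := by
  cases hk : c.secret a.session P with
  | none => exact absurd hk (hst.2.2 P)
  | some k =>
    have hk' := h.coin _ _ hk
    cases k with
    | revealed N =>
      have : N = (coin a.session).toNat := Option.some.inj hk'
      rw [this]
    | committed N =>
      have hN : N = some (coin a.session).toNat := hk'
      subst hN
      refine absurd (Due.reveal (c := c.ownView P) ha hD hc hP ht ?_) (hdue _)
      have e1 : (c.ownView P).advert a.session = none := hst.2.1
      -- Stipulation makes the secret of `P` visible to `P`; while pending it would appear as `⊥`,
      -- and revealing it would not be enabled.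
      have e2 : (c.ownView P).secret a.session P =
          some (.committed (some (coin a.session).toNat)) := by
        simp [Config.ownView, Config.hide, hk, hst.2.1]
      simp [Config.Enabled, Config.step, e1, e2]

theorem not_put_of_threat (hdue : ∀ m, ¬ Due P (c.ownView P) m)
    {ss : List Player} {p : Pred} {C : Contract}
    (ha : c.active x = some a) (hD : a.body[i]? = some D) (hc : D.core = .put ss p C)
    (hP : P ∈ ss) (ht : Threat P c a) (hrel : D.release = 0)
    (hrev : ∀ R ∈ ss, (c.revealed? a.session R).isSome) :
    ¬ p.eval (fun R => (((c.revealed? a.session R).getD 0 : ℕ) : ℤ)) = true := by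
  intro hev
  refine hdue _ (.put (c := c.ownView P) ha hD hc hP ht
    (fire_put_isSome (c := c.ownView P) ha hD (by rw [hrel]; exact Nat.zero_le _) hc ?_ ?_))
  · simpa only [revealed?_ownView] using hrev
  · simpa only [revealed?_ownView] using hev

end enabled

/-- At the last admissible time some move is due: a withdrawal or split, or, under a threat, the
revelation and then the `put`. So `P` does not accept the tick. -/
theorem Inv.fits_tick (h : Inv P coin c) (hdue : ∀ m, ¬ Due P (c.ownView P) m) {y : ℕ} {a : Active}
    (ha : c.active y = some a) {p : Phase} (hp : a.body = p.body) (hf : Fits P c a p) :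
    Fits P { c with time := c.time + 1 } a p := by
  cases p with
  | round L n =>
    obtain ⟨h1, h2, h3⟩ := hf
    refine ⟨h1, h2, ?_⟩
    change c.time + 1 ≤ _
    have hD0 : a.body[0]? = some (.put [.B] bitB (flipBody L n)) := by rw [hp]; rfl
    have hD1 : a.body[1]? = some (.after (3 * n + 1) (.withdraw .A)) := by rw [hp]; rfl
    cases P with
    | A =>
      have : c.time < max (3 * n + 1) 0 := time_lt_of_withdraw hdue ha hD1 rfl
      simp only [roundSlack]
      omega
    | B =>
      by_contra hlt
      simp only [roundSlack] at hlt h3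
      have ht : Threat .B c a :=
        ⟨_, List.mem_of_getElem? hD1, rfl, by simp only [Guarded.release]; omega⟩
      have hr := revealed_of_threat h hdue ha hD0 rfl (by simp) h2 ht
      have hr' := Config.revealed?_eq_some.2 hr
      -- The secret of `P` is a bit and passes `bitB`, so the `put` would be executable.
      refine not_put_of_threat hdue ha hD0 rfl (by simp) ht rfl (by simp [hr']) ?_
      rw [bitB_eval, hr']
      have := Bool.toNat_le (coin a.session)
      exact ⟨Int.natCast_nonneg _, by exact_mod_cast this⟩
  | flip L n =>
    obtain ⟨h1, h2, h3, N, hN, hB⟩ := hf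
    refine ⟨h1, h2, ?_, N, hN, hB⟩
    change c.time + 1 ≤ _
    have hD0 : a.body[0]? = some (.put [.A, .B] sameAB (contBody L n .A)) := by rw [hp]; rfl
    have hD1 : a.body[1]? = some (.put [.A, .B] (.not sameAB) (contBody L n .B)) := by
      rw [hp]; rfl
    have hD2 : a.body[2]? = some (.after (3 * n + 2) (.withdraw .B)) := by rw [hp]; rfl
    cases P with
    | B =>
      have : c.time < max (3 * n + 2) 0 := time_lt_of_withdraw hdue ha hD2 rfl
      simp only [flipSlack]
      omega
    | A =>
      by_contra hlt
      simp only [flipSlack] at hlt h3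
      have ht : Threat .A c a :=
        ⟨_, List.mem_of_getElem? hD2, rfl, by simp only [Guarded.release]; omega⟩
      have hr := Config.revealed?_eq_some.2
        (revealed_of_threat h hdue ha hD0 rfl (by simp) h2 ht)
      have hB' := Config.revealed?_eq_some.2 hB
      -- Both secrets are revealed, so one of the tests `a = b` and `a ≠ b` succeeds and its `put`
      -- is due.
      have h0 := not_put_of_threat hdue ha hD0 rfl (by simp) ht rfl (by simp [hr, hB'])
      have h1 := not_put_of_threat hdue ha hD1 rfl (by simp) ht rfl (by simp [hr, hB'])
      rw [Pred.eval, Bool.not_eq_true'] at h1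
      exact h0 ((Bool.not_eq_false _).mp h1)
  | wait n W =>
    obtain ⟨h1, h2⟩ := hf
    have hD1 : a.body[1]? = some (.after (3 * n + 3) (splitFor W)) := by rw [hp]; rfl
    have : c.time < max (3 * n + 3) 0 := time_lt_of_split hdue ha hD1 rfl (by rw [h1]; rfl)
    refine ⟨h1, ?_⟩
    change c.time + 1 ≤ _
    omega
  | leaf W => trivial

theorem Inv.tick (h : Inv P coin c) (hdue : ∀ m, ¬ Due P (c.ownView P) m) :
    Inv P coin { c with time := c.time + 1 } :=
  ⟨h.fresh_pos, h.fresh_active, h.fresh_advert, h.fresh_secret, h.coin, h.pending, h.auth,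
    h.parent_lt, h.parent, fun y a ha =>
      let ⟨p, hp, hf⟩ := h.phase y a ha
      ⟨p, hp, h.fits_tick hdue ha hp hf⟩, h.wealth⟩

/-- When `P` lets time pass after the first `K` rounds, everything of value has been received. -/
theorem Inv.potential_eq_received (h : Inv P coin c) (hdue : ∀ m, ¬ Due P (c.ownView P) m) {K : ℕ}
    (hK : 3 * K < c.time) : potential K P c = c.received P := by
  unfold potential Config.sum
  rw [Finset.sum_eq_zero, add_zero]
  intro y _
  cases ha : c.active y with
  | none => rfl
  | some a =>
    change value K P c.num a = 0
    obtain ⟨p, hp, hf⟩ := h.phase y a ha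
    cases p with
    | round L n =>
      have h1 := hf.2.2
      -- Now `3 * K < 3 * n + 2` at most leaves room for `K ≤ n`, that is, for worthless rounds.
      have h2 : roundSlack P ≤ 2 := by cases P <;> simp [roundSlack]
      rw [value_round hp, contShare_eq_zero (by omega)]
    | flip L n =>
      have h1 := hf.2.2.1
      have h2 : flipSlack P ≤ 2 := by cases P <;> simp [flipSlack]
      rw [value_flip hp, contShare_eq_zero (by omega)]
    | wait n W =>
      have h1 := hf.2
      rw [value_wait hp, share_eq_zero (by omega)]
    | leaf W =>
      rw [value_leaf hp, if_neg]
      rintro rfl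
      have hD : a.body[0]? = some (.withdraw W) := by rw [hp]; rfl
      have : c.time < 0 := time_lt_of_withdraw hdue ha hD rfl
      omega

theorem Inv.step (h : Inv P coin c) {m : Move} {N : Option ℕ}
    (hi : c.step m (chosen P coin m N) = some c')
    (htick : m = .tick → ∀ m', ¬ Due P (c.ownView P) m') :
    Inv P coin c' ∧
      ∀ K, (∀ s, m ≠ .init s) ∨ 3 * K < c.time → potential K P c ≤ potential K P c' := by
  cases m with
  | tick =>
    obtain rfl := Option.some.inj hi
    exact ⟨h.tick (htick rfl), fun _ _ => le_rfl⟩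
  | fire x i => exact ⟨(h.fire hi).1, fun K _ => (h.fire hi).2 K⟩
  | advertise x i => exact ⟨(h.advertise hi).1, fun K _ => ((h.advertise hi).2 K).ge⟩
  | commit R s =>
    have hN : R = P → chosen P coin (.commit R s) N = some (coin s).toNat := fun e => by
      simp [chosen, e]
    exact ⟨(h.commit hN hi).1, fun K _ => ((h.commit hN hi).2 K).ge⟩
  | authorize R s => exact ⟨(h.authorize hi).1, fun K _ => ((h.authorize hi).2 K).ge⟩
  | init s =>
    exact ⟨Inv.init h hi, fun K hK =>
      h.init_late hi (hK.resolve_left fun e => absurd rfl (e s))⟩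
  | reveal R s => exact ⟨(h.reveal hi).1, fun K _ => ((h.reveal hi).2 K).ge⟩

/-! ### Bounds on the potential. -/

theorem potential_nonneg (K : ℕ) (P : Player) (c : Config) : 0 ≤ potential K P c := by
  unfold potential Config.sum
  refine add_nonneg (Nat.cast_nonneg _) (Finset.sum_nonneg fun y _ => ?_)
  cases c.active y with
  | none => exact le_rfl
  | some a => exact value_nonneg _ _ _ _

theorem received_add_other (c : Config) :
    (c.received .A + c.received .B : ℝ) = c.received P + c.received P.other := by
  cases P
  · rfl
  · exact add_comm _ _

theorem Inv.potential_le (h : Inv P coin c) (K : ℕ) : potential K P c ≤ 6 := by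
  rw [← h.wealth]
  unfold potential BitML.wealth
  rw [received_add_other (P := P)]
  have : c.sum (value K P c.num) ≤ c.sum fun a => a.balance := by
    refine Finset.sum_le_sum fun y _ => ?_
    cases ha : c.active y with
    | none => exact le_rfl
    | some a =>
      obtain ⟨p, hp, hf⟩ := h.phase y a ha
      exact hf.value_le hp
  have : (0 : ℝ) ≤ c.received P.other := Nat.cast_nonneg _
  linarith

theorem Inv.received_le (h : Inv P coin c) : (c.received P : ℝ) ≤ 6 := by
  refine le_trans ?_ (h.potential_le 0)
  unfold potential
  refine le_add_of_nonneg_right (Finset.sum_nonneg fun y _ => ?_)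
  cases c.active y with
  | none => exact le_rfl
  | some a => exact value_nonneg _ _ _ _

/-! ### The start -/

theorem inv_start {N : Player → Option ℕ} (hN : N P = some (coin 0).toNat) :
    Inv P coin (start N) := by
  have hact : ∀ {y a}, (start N).active y = some a → y = 0 ∧ a = ⟨CFG, 6, 0⟩ := by
    intro y a ha
    simp only [start] at ha
    split_ifs at ha with e
    exact ⟨e, (Option.some.inj ha).symm⟩
  refine ⟨one_pos, ?_, fun _ _ => rfl, ?_, ?_, ?_, ?_, ?_, ?_, ?_, ?_⟩
  · intro y hy
    have hy : 1 ≤ y := hy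
    simp only [start]
    rw [if_neg (by omega)]
  · intro y R hy
    have hy : 1 ≤ y := hy
    simp only [start]
    rw [if_neg (by omega)]
  · intro s k hk
    simp only [start] at hk
    split_ifs at hk with e
    rw [← Option.some.inj hk, e]
    exact hN
  · exact fun s R N h => absurd rfl h
  · intro s d R hd; cases hd
  · intro s d hd; cases hd
  · intro s d a hd; cases hd
  · intro y a ha
    obtain ⟨-, rfl⟩ := hact ha
    refine ⟨.round none 0, CFG_eq, rfl, ⟨one_pos, rfl, fun Q => ?_⟩, Nat.zero_le _⟩
    simp [start]
  · simp [BitML.wealth, Config.sum, start]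

theorem potential_start (K : ℕ) (P : Player) (N : Player → Option ℕ) :
    potential K P (start N) = contShare K P none 0 (winner P N) := by
  have : (start N).num 0 = N := by
    funext R
    simp [Config.num, start, Commitment.num]
  simp only [potential, Config.sum, start, Finset.sum_range_one, if_true, Option.elim]
  rw [value_round (L := none) (n := 0) CFG_eq]
  simp only [Nat.cast_zero, zero_add]
  exact congrArg (fun v => contShare K P none 0 (winner P v)) this

end BitML

namespace BitML

variable {P : Player} {σ : Strategy} {τ : Opponent} {coin : ℕ → Bool} {c c' : Config}

/-! ### Non-interference -/

/-- The secret of session `s` is hidden before its stipulation. -/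
def Config.Hidden (c : Config) (s : ℕ) : Prop := c.fresh ≤ s ∨ c.advert s ≠ none

def flipAt (s : ℕ) (coin : ℕ → Bool) : ℕ → Bool := fun i => if i = s then !coin i else coin i

theorem revealed?_swap (s t : ℕ) (R : Player) :
    (c.swap s P).revealed? t R = c.revealed? t R := by
  unfold Config.revealed? Config.swap
  dsimp only
  split_ifs with e
  · cases h : c.secret t R with
    | none => simp
    | some k => cases k <;> simp [Commitment.swap]
  · rfl

theorem opponentView_swap (s : ℕ) : (c.swap s P).opponentView P = c.opponentView P := by
  unfold Config.opponentView Config.hide Config.swap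
  congr 1
  funext t R
  dsimp only
  by_cases e : t = s ∧ R = P
  · obtain ⟨rfl, rfl⟩ := e
    cases h : c.secret t R with
    | none => simp
    | some k => cases k <;> simp [Commitment.swap]
  · simp only [if_neg e]

/-- This is the condition that `P` does not act on a secret before its stipulation. -/
theorem ownView_swap (h : Inv P coin c) {s : ℕ} (hs : c.Hidden s) :
    (c.swap s P).ownView P = c.ownView P := by
  unfold Config.ownView Config.hide Config.swap
  congr 1
  funext t R
  dsimp only
  by_cases e : t = s ∧ R = P
  · obtain ⟨rfl, rfl⟩ := e
    rcases hs with hs | hs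
    · simp [h.fresh_secret t R hs]
    · have : (c.advert t).isNone = false := by rwa [Option.isNone_eq_false_iff, ← Option.ne_none_iff_isSome]
      cases h : c.secret t R with
      | none => simp
      | some k => cases k <;> simp [Commitment.swap, this]
  · simp only [if_neg e]

theorem fire_swap (s x i : ℕ) : (c.swap s P).fire x i = (c.fire x i).map (·.swap s P) := by
  have e1 : (c.swap s P).active = c.active := rfl
  have e2 : (c.swap s P).time = c.time := rfl
  unfold Config.fire
  simp only [revealed?_swap, e1, e2]
  cases c.active x with
  | none => rfl
  | some a =>
    cases hD : a.body[i]? with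
    | none => simp [hD]
    | some D =>
      simp only [hD]
      split_ifs
      · cases D.core <;> dsimp only <;> (try split_ifs) <;> rfl
      · rfl

theorem advertise_swap (s x i : ℕ) :
    (c.swap s P).advertise x i = (c.advertise x i).map (·.swap s P) := by
  have e1 : (c.swap s P).active = c.active := rfl
  have e2 : (c.swap s P).time = c.time := rfl
  have e3 : (c.swap s P).fresh = c.fresh := rfl
  have e4 : (c.swap s P).advert = c.advert := rfl
  unfold Config.advertise
  simp only [e1, e2, e3, e4]
  cases c.active x with
  | none => rfl
  | some a =>
    cases hD : a.body[i]? with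
    | none => simp [hD]
    | some D =>
      simp only [hD]
      split_ifs
      · cases D.core <;> dsimp only <;> (try split_ifs) <;> rfl
      · rfl

theorem init_swap (s t : ℕ) : (c.swap s P).init t = (c.init t).map (·.swap s P) := by
  have e1 : (c.swap s P).active = c.active := rfl
  have e4 : (c.swap s P).advert = c.advert := rfl
  unfold Config.init
  simp only [e1, e4]
  cases c.advert t with
  | none => rfl
  | some d =>
    dsimp only
    cases c.active d.parent with
    | none => rfl
    | some a =>
      dsimp only
      split_ifs <;> rfl

theorem swap_secret_of_ne {s t : ℕ} {R : Player} (h : ¬ (t = s ∧ R = P)) :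
    (c.swap s P).secret t R = c.secret t R := if_neg h

theorem swap_secret_self (s : ℕ) :
    (c.swap s P).secret s P = (c.secret s P).map Commitment.swap := if_pos ⟨rfl, rfl⟩

theorem swap_setSecret_self (s : ℕ) (k : Commitment) :
    (c.swap s P).setSecret s P k.swap = (c.setSecret s P k).swap s P := by
  unfold Config.swap Config.setSecret
  congr 1
  funext t R
  simp only [Function.update_apply]
  by_cases ht : t = s <;> by_cases hR : R = P <;> simp [ht, hR]

theorem swap_setSecret_of_ne {s t : ℕ} {R : Player} (h : ¬ (t = s ∧ R = P)) (k : Commitment) :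
    (c.swap s P).setSecret t R k = (c.setSecret t R k).swap s P := by
  unfold Config.swap Config.setSecret
  congr 1
  funext u Q
  simp only [Function.update_apply]
  by_cases hu : u = t
  · by_cases hQ : Q = R
    · subst hu hQ
      simp [h]
    · subst hu
      simp [hQ]
  · simp [hu]

/-- Coin and secret are flipped together: a commitment of `P` in session `s` draws the swapped
secret. -/
theorem commit_swap (s : ℕ) (R : Player) (t : ℕ) (N : Option ℕ) :
    (c.swap s P).step (.commit R t) (chosen P (flipAt s coin) (.commit R t) N) =
      (c.step (.commit R t) (chosen P coin (.commit R t) N)).map (·.swap s P) := by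
  have e4 : (c.swap s P).advert = c.advert := rfl
  unfold Config.step
  simp only [e4]
  cases c.advert t with
  | none => rfl
  | some d =>
    by_cases e : t = s ∧ R = P
    · obtain ⟨rfl, rfl⟩ := e
      rw [swap_secret_self]
      cases c.secret t R with
      | some k => rfl
      | none =>
        simp only [Option.map_none, Option.map_some, ← swap_setSecret_self]
        simp only [chosen, if_true, flipAt, Commitment.swap]
        cases coin t <;> rfl
    · rw [swap_secret_of_ne e]
      cases c.secret t R with
      | some k => rfl
      | none =>
        simp only [Option.map_some, swap_setSecret_of_ne e]
        congr 4
        simp only [chosen, flipAt]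
        split_ifs with h1 h2
        · exact absurd ⟨h2, h1⟩ e
        · rfl
        · rfl

theorem authorize_swap (s : ℕ) (R : Player) (t : ℕ) (N N' : Option ℕ) :
    (c.swap s P).step (.authorize R t) N' =
      (c.step (.authorize R t) N).map (·.swap s P) := by
  have e4 : (c.swap s P).advert = c.advert := rfl
  have e5 : ∀ Q, (c.swap s P).secret t Q =
      if t = s ∧ Q = P then (c.secret t Q).map Commitment.swap else c.secret t Q := fun _ => rfl
  unfold Config.step
  simp only [e4, e5]
  cases c.advert t with
  | none => rfl
  | some d =>
    cases hA : c.secret t .A <;> cases hB : c.secret t .B <;> simp <;> (split_ifs <;> (simp; rfl))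

/-- Only here is hiddenness needed. A revelation requires that no advertisement is pending, and a
hidden session without one is unused and has no secret. -/
theorem reveal_swap (h : Inv P coin c) {s : ℕ} (hs : c.Hidden s) (R : Player) (t : ℕ)
    (N N' : Option ℕ) :
    (c.swap s P).step (.reveal R t) N' = (c.step (.reveal R t) N).map (·.swap s P) := by
  have e4 : (c.swap s P).advert = c.advert := rfl
  unfold Config.step
  simp only [e4]
  cases hadv : c.advert t with
  | some d => rfl
  | none =>
    by_cases e : t = s ∧ R = P
    · obtain ⟨rfl, rfl⟩ := e
      rw [swap_secret_self, h.fresh_secret t R (hs.resolve_right fun hs => hs hadv)]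
      rfl
    · rw [swap_secret_of_ne e]
      cases c.secret t R with
      | none => rfl
      | some k =>
        cases k with
        | revealed M => rfl
        | committed M =>
          cases M with
          | none => rfl
          | some M => simp only [Option.map_some, swap_setSecret_of_ne e]

theorem step_swap (h : Inv P coin c) {s : ℕ} (hs : c.Hidden s) (m : Move) (N : Option ℕ) :
    (c.swap s P).step m (chosen P (flipAt s coin) m N) =
      (c.step m (chosen P coin m N)).map (·.swap s P) := by
  cases m with
  | tick => rfl
  | fire x i => exact fire_swap s x i
  | advertise x i => exact advertise_swap s x i
  | commit R t => exact commit_swap s R t N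
  | authorize R t => exact authorize_swap s R t _ _
  | init t => exact init_swap s t
  | reveal R t => exact reveal_swap h hs R t _ _

/-- Names are never reused, so a session that has ceased to be hidden stays so. Hiddenness at step
`n` thus covers the whole past in `play_flipAt`. -/
theorem Config.Hidden.of_step {m : Move} {N : Option ℕ} {s : ℕ} (hi : c.step m N = some c')
    (hs : c'.Hidden s) : c.Hidden s := by
  by_contra hc
  unfold Config.Hidden at hc hs
  push Not at hc
  obtain ⟨h1, h2⟩ := hc
  have : c.fresh ≤ c'.fresh ∧ c'.advert s = none := by
    cases m with
    | tick =>
      obtain rfl := Option.some.inj hi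
      exact ⟨le_rfl, h2⟩
    | fire x i =>
      obtain ⟨a, D, -, -, -, ⟨_, _, _, -, -, -, rfl⟩ | ⟨_, -, rfl⟩ | ⟨_, -, -, rfl⟩⟩ :=
        Config.fire_eq_some hi <;> exact ⟨Nat.le_add_right _ _, h2⟩
    | advertise x i =>
      obtain ⟨a, D, X, k, -, -, -, rfl⟩ := Config.advertise_eq_some hi
      exact ⟨Nat.le_succ _, by simpa [Function.update_apply, h1.ne] using h2⟩
    | commit R t =>
      simp only [Config.step] at hi
      split at hi
      · obtain rfl := Option.some.inj hi
        exact ⟨le_rfl, h2⟩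
      · cases hi
    | authorize R t =>
      simp only [Config.step] at hi
      split at hi
      · rename_i d _ _ hd _ _
        obtain rfl := Option.some.inj hi
        have : s ≠ t := by
          rintro rfl
          rw [h2] at hd; cases hd
        exact ⟨le_rfl, by simpa [Function.update_apply, this] using h2⟩
      · cases hi
    | init t =>
      obtain ⟨d, a, -, -, -, rfl⟩ := Config.init_eq_some hi
      refine ⟨Nat.le_add_right _ _, ?_⟩
      change Function.update c.advert t none s = none
      by_cases e : s = t <;> simp [e, h2]
    | reveal R t =>
      simp only [Config.step] at hi
      split at hi
      · obtain rfl := Option.some.inj hi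
        exact ⟨le_rfl, h2⟩
      · cases hi
  rcases hs with hs | hs
  · omega
  · exact hs this.2

/-! ### The play -/

section play

variable (P σ τ coin)

/-- The history of the play up to and including its `n`-th configuration. -/
noncomputable def history (n : ℕ) : List Config :=
  (play P σ τ coin n).1 :: (play P σ τ coin n).2

/-- The choice of the opponent at the `n`-th step. -/
noncomputable def choice (n : ℕ) : Move × Option ℕ :=
  τ.next ((history P σ τ coin n).map (Config.opponentView P))

/-- Whether the choice of the opponent at the `n`-th step is permitted by `P`. -/
def Permitted (n : ℕ) : Prop :=
  Allowed P (σ ((history P σ τ coin n).map (Config.ownView P))) (choice P σ τ coin n).1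

theorem play_succ_snd (n : ℕ) : (play P σ τ coin (n + 1)).2 = history P σ τ coin n := by
  simp only [play, history]
  split_ifs <;> rfl

open Classical in
theorem play_succ_fst (n : ℕ) : (play P σ τ coin (n + 1)).1 =
    if Permitted P σ τ coin n then
      ((play P σ τ coin n).1.step (choice P σ τ coin n).1
        (chosen P coin (choice P σ τ coin n).1 (choice P σ τ coin n).2)).getD
        (play P σ τ coin n).1
    else (play P σ τ coin n).1 := by
  by_cases h : Permitted P σ τ coin n
  · rw [if_pos h]
    exact congrArg Prod.fst (if_pos h)
  · rw [if_neg h]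
    have e : play P σ τ coin (n + 1) = ((play P σ τ coin n).1, history P σ τ coin n) := if_neg h
    rw [e]

/-- The session that is stipulated at the `n`-th step, if any. -/
noncomputable def stipulation (n : ℕ) : Option ℕ :=
  match (choice P σ τ coin n).1 with
  | .init s => if ((play P σ τ coin n).1.init s).isSome then some s else none
  | _ => none

variable {P σ τ coin}

theorem play_step (n : ℕ) : (play P σ τ coin (n + 1)).1 = (play P σ τ coin n).1 ∨
    Permitted P σ τ coin n ∧
    (play P σ τ coin n).1.step (choice P σ τ coin n).1
        (chosen P coin (choice P σ τ coin n).1 (choice P σ τ coin n).2) =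
      some (play P σ τ coin (n + 1)).1 := by
  rw [play_succ_fst]
  split_ifs with h
  · cases e : (play P σ τ coin n).1.step (choice P σ τ coin n).1
        (chosen P coin (choice P σ τ coin n).1 (choice P σ τ coin n).2) with
    | none => exact Or.inl rfl
    | some c => exact Or.inr ⟨h, rfl⟩
  · exact Or.inl rfl

theorem not_due_of_permitted (hσ : Rational P σ) {n : ℕ} (h : Permitted P σ τ coin n)
    (ht : (choice P σ τ coin n).1 = .tick) (m : Move) :
    ¬ Due P ((play P σ τ coin n).1.ownView P) m := by
  unfold Permitted at h
  rw [ht] at h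
  rcases h with h | h
  · exact hσ.tick _ _ h m
  · exact absurd rfl h.1

theorem inv_play (hσ : Rational P σ) (n : ℕ) : Inv P coin (play P σ τ coin n).1 := by
  induction n with
  | zero => exact inv_start (by simp)
  | succ n ih =>
    rcases play_step (P := P) (σ := σ) (τ := τ) (coin := coin) n with e | ⟨hp, e⟩
    · rw [e]; exact ih
    · exact (ih.step e fun ht => not_due_of_permitted hσ hp ht).1

theorem potential_play_le (hσ : Rational P σ) {n K : ℕ}
    (h : stipulation P σ τ coin n = none ∨ 3 * K < (play P σ τ coin n).1.time) :
    potential K P (play P σ τ coin n).1 ≤ potential K P (play P σ τ coin (n + 1)).1 := by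
  rcases play_step (P := P) (σ := σ) (τ := τ) (coin := coin) n with e | ⟨hp, e⟩
  · rw [e]
  · refine ((inv_play hσ n).step e fun ht => not_due_of_permitted hσ hp ht).2 K
      (h.imp (fun h s hs => ?_) id)
    rw [hs] at e
    have e : (play P σ τ coin n).1.init s = some _ := e
    simp [stipulation, hs, e] at h

theorem init_of_stipulation {n s : ℕ} (h : stipulation P σ τ coin n = some s) :
    (play P σ τ coin n).1.init s = some (play P σ τ coin (n + 1)).1 := by
  unfold stipulation at h
  split at h
  · rename_i t ht
    split_ifs at h with hi
    obtain rfl := Option.some.inj h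
    -- A stipulation is owned by nobody and hence always permitted.
    have hp : Permitted P σ τ coin n := by
      unfold Permitted
      rw [ht]
      exact Or.inr ⟨by simp, fun h => h⟩
    rw [play_succ_fst, if_pos hp, ht]
    obtain ⟨c, hc⟩ := Option.isSome_iff_exists.1 hi
    simp [Config.step, hc]
  · cases h

theorem hidden_of_stipulation {n s : ℕ} (h : stipulation P σ τ coin n = some s) :
    (play P σ τ coin n).1.Hidden s := by
  obtain ⟨d, -, hd, -⟩ := Config.init_eq_some (init_of_stipulation h)
  exact Or.inr (by simp [hd])

theorem hidden_of_hidden_succ {n s : ℕ} (h : (play P σ τ coin (n + 1)).1.Hidden s) :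
    (play P σ τ coin n).1.Hidden s := by
  rcases play_step (P := P) (σ := σ) (τ := τ) (coin := coin) n with e | ⟨-, e⟩
  · rwa [e] at h
  · exact h.of_step e

theorem history_views_flipAt (hσ : Rational P σ) {n s : ℕ}
    (hs : (play P σ τ coin n).1.Hidden s)
    (h : (play P σ τ (flipAt s coin) n).1 = (play P σ τ coin n).1.swap s P ∧
      (play P σ τ (flipAt s coin) n).2.map (Config.opponentView P) =
        (play P σ τ coin n).2.map (Config.opponentView P) ∧
      (play P σ τ (flipAt s coin) n).2.map (Config.ownView P) =
        (play P σ τ coin n).2.map (Config.ownView P)) :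
    (history P σ τ (flipAt s coin) n).map (Config.opponentView P) =
        (history P σ τ coin n).map (Config.opponentView P) ∧
      (history P σ τ (flipAt s coin) n).map (Config.ownView P) =
        (history P σ τ coin n).map (Config.ownView P) := by
  obtain ⟨h1, h2, h3⟩ := h
  simp only [history, List.map_cons, h1, h2, h3, opponentView_swap,
    ownView_swap (inv_play hσ n) hs, and_self]

theorem play_succ_flipAt_of_views (hσ : Rational P σ) {n s : ℕ}
    (hs : (play P σ τ coin n).1.Hidden s)
    (h : (play P σ τ (flipAt s coin) n).1 = (play P σ τ coin n).1.swap s P)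
    (hv : (history P σ τ (flipAt s coin) n).map (Config.opponentView P) =
        (history P σ τ coin n).map (Config.opponentView P) ∧
      (history P σ τ (flipAt s coin) n).map (Config.ownView P) =
        (history P σ τ coin n).map (Config.ownView P)) :
    (play P σ τ (flipAt s coin) (n + 1)).1 = (play P σ τ coin (n + 1)).1.swap s P := by
  have hc : choice P σ τ (flipAt s coin) n = choice P σ τ coin n := by
    simp only [choice, hv.1]
  have hp : Permitted P σ τ (flipAt s coin) n ↔ Permitted P σ τ coin n := by
    simp only [Permitted, hv.2, hc]
  rw [play_succ_fst, play_succ_fst, hc, h, step_swap (inv_play hσ n) hs]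
  by_cases h' : Permitted P σ τ coin n
  · rw [if_pos h', if_pos (hp.2 h')]
    cases (play P σ τ coin n).1.step (choice P σ τ coin n).1
        (chosen P coin (choice P σ τ coin n).1 (choice P σ τ coin n).2) <;> rfl
  · rw [if_neg h', if_neg (mt hp.1 h')]

/-- Non-interference: as both observed histories agree, both strategies act alike, and each step
commutes with the swap. -/
theorem play_flipAt (hσ : Rational P σ) {n s : ℕ} (hs : (play P σ τ coin n).1.Hidden s) :
    (play P σ τ (flipAt s coin) n).1 = (play P σ τ coin n).1.swap s P ∧
      (play P σ τ (flipAt s coin) n).2.map (Config.opponentView P) =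
        (play P σ τ coin n).2.map (Config.opponentView P) ∧
      (play P σ τ (flipAt s coin) n).2.map (Config.ownView P) =
        (play P σ τ coin n).2.map (Config.ownView P) := by
  induction n with
  | zero =>
    -- Session 0 is stipulated from the outset, so its coin is never hidden.
    have hs0 : s ≠ 0 := by
      rintro rfl
      rcases hs with hs | hs
      · exact absurd hs (by simp [play, start])
      · exact hs rfl
    refine ⟨?_, rfl, rfl⟩
    have e0 : flipAt s coin 0 = coin 0 := if_neg hs0.symm
    simp only [play, e0, start, Config.swap]
    congr 1
    funext t R
    by_cases ht : t = 0
    · subst ht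
      simp [hs0.symm]
    · simp [ht]
  | succ n ih =>
    have hs' := hidden_of_hidden_succ hs
    have ih := ih hs'
    have hv := history_views_flipAt hσ hs' ih
    refine ⟨play_succ_flipAt_of_views hσ hs' ih.1 hv, ?_⟩
    rw [play_succ_snd, play_succ_snd]
    exact hv

/-- Hiddenness is needed only before the step, so the stipulating step itself is included. -/
theorem play_succ_flipAt (hσ : Rational P σ) {n s : ℕ} (hs : (play P σ τ coin n).1.Hidden s) :
    (play P σ τ (flipAt s coin) (n + 1)).1 = (play P σ τ coin (n + 1)).1.swap s P :=
  play_succ_flipAt_of_views hσ hs (play_flipAt hσ hs).1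
    (history_views_flipAt hσ hs (play_flipAt hσ hs))

theorem stipulation_flipAt (hσ : Rational P σ) {n s : ℕ}
    (h : stipulation P σ τ coin n = some s) : stipulation P σ τ (flipAt s coin) n = some s := by
  have hs := hidden_of_stipulation h
  have hv := history_views_flipAt hσ hs (play_flipAt hσ hs)
  have hc : choice P σ τ (flipAt s coin) n = choice P σ τ coin n := by
    simp only [choice, hv.1]
  unfold stipulation at h ⊢
  rw [hc, (play_flipAt hσ hs).1]
  simpa only [init_swap, Option.isSome_map] using h

theorem potential_stipulation (hσ : Rational P σ) {n s : ℕ}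
    (h : stipulation P σ τ coin n = some s) (K : ℕ) :
    potential K P (play P σ τ coin n).1 + potential K P (play P σ τ (flipAt s coin) n).1 ≤
      potential K P (play P σ τ coin (n + 1)).1 +
        potential K P (play P σ τ (flipAt s coin) (n + 1)).1 := by
  have hs := hidden_of_stipulation h
  have h1 := (inv_play hσ n).init_average (init_of_stipulation h) K
  have hi : (play P σ τ (flipAt s coin) n).1.init s =
      some (play P σ τ (flipAt s coin) (n + 1)).1 :=
    init_of_stipulation (stipulation_flipAt hσ h)
  have h2 : potential K P (play P σ τ (flipAt s coin) n).1 = potential K P (play P σ τ coin n).1 := by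
    rw [(play_flipAt hσ hs).1]
    obtain ⟨d, -, hd, -⟩ := Config.init_eq_some (init_of_stipulation h)
    refine (inv_play hσ n).potential_congr K rfl rfl rfl fun t ht => ?_
    have : t ≠ s := by
      rintro rfl
      rw [ht.2.1] at hd
      cases hd
    funext Q
    simp [Config.num, Config.swap, this]
  rw [h2, play_succ_flipAt hσ hs]
  linarith

end play

end BitML

namespace BitML

/-! ### Measurability -/

/-- A function with countably many values, each of them on a measurable set. -/
def CountablyValued {Ω α : Type*} [MeasurableSpace Ω] (f : Ω → α) : Prop :=
  (Set.range f).Countable ∧ ∀ a, MeasurableSet (f ⁻¹' {a})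

namespace CountablyValued

variable {Ω α β : Type*} [MeasurableSpace Ω]

theorem const (a : α) : CountablyValued fun _ : Ω => a :=
  ⟨(Set.countable_singleton a).mono (by rintro _ ⟨ω, rfl⟩; rfl), fun b => by
    by_cases h : a = b <;> simp [Set.preimage, h]⟩

theorem of_countable [Countable α] {f : Ω → α} (h : ∀ a, MeasurableSet (f ⁻¹' {a})) :
    CountablyValued f :=
  ⟨Set.to_countable _, h⟩

theorem bind {f : Ω → α} (hf : CountablyValued f) {F : α → Ω → β}
    (hF : ∀ a, CountablyValued (F a)) : CountablyValued fun ω => F (f ω) ω := by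
  constructor
  · refine (hf.1.biUnion fun a _ => (hF a).1).mono ?_
    rintro _ ⟨ω, rfl⟩
    exact Set.mem_biUnion (Set.mem_range_self ω) ⟨ω, rfl⟩
  · intro b
    have : (fun ω => F (f ω) ω) ⁻¹' {b} = ⋃ a ∈ Set.range f, f ⁻¹' {a} ∩ F a ⁻¹' {b} := by
      ext ω
      simp only [Set.mem_preimage, Set.mem_singleton_iff, Set.mem_iUnion, Set.mem_inter_iff,
        exists_prop]
      exact ⟨fun h => ⟨f ω, ⟨ω, rfl⟩, rfl, h⟩, by rintro ⟨_, -, rfl, h⟩; exact h⟩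
    rw [this]
    exact MeasurableSet.biUnion hf.1 fun a _ => (hf.2 a).inter ((hF a).2 b)

theorem comp {f : Ω → α} (hf : CountablyValued f) (g : α → β) :
    CountablyValued fun ω => g (f ω) :=
  hf.bind (F := fun a _ => g a) fun a => const (g a)

theorem measurable_comp [MeasurableSpace β] {f : Ω → α} (hf : CountablyValued f) (g : α → β) :
    Measurable fun ω => g (f ω) := by
  intro s _
  have : (fun ω => g (f ω)) ⁻¹' s = ⋃ a ∈ Set.range f ∩ g ⁻¹' s, f ⁻¹' {a} := by
    ext ω
    simp
  rw [this]
  exact MeasurableSet.biUnion (hf.1.mono Set.inter_subset_left) fun a _ => hf.2 a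

end CountablyValued

instance : Countable Player :=
  Function.Injective.countable (f := fun P : Player => decide (P = .A)) (by
    intro P Q h
    cases P <;> cases Q <;> first | rfl | simp at h)

instance : Countable Move :=
  Function.Injective.countable (β := ℕ × ℕ × ℕ × Player) (f := fun m => match m with
    | .tick => (0, 0, 0, .A)
    | .fire x i => (1, x, i, .A)
    | .advertise x i => (2, x, i, .A)
    | .commit P s => (3, s, 0, P)
    | .authorize P s => (4, s, 0, P)
    | .init s => (5, s, 0, .A)
    | .reveal P s => (6, s, 0, P)) (by
    intro m m' h
    cases m <;> cases m' <;> simp_all)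

variable {R : Type*} [MeasurableSpace R] {P : Player} {σ : R → Strategy} {τ : R → Opponent}

-- Measurability of the strategies is assumed for fixed histories only. Since countably many
-- histories arise in `n` steps, one may fix in turn the history, the choice of the opponent and the
-- permission of `P`.
open Classical in
theorem countablyValued_play
    (hσ : ∀ (h : List Config) (m : Move), MeasurableSet {r | m ∈ σ r h})
    (hτ₀ : ∀ N : Option ℕ, MeasurableSet {r | (τ r).secret = N})
    (hτ : ∀ (h : List Config) (q : Move × Option ℕ), MeasurableSet {r | (τ r).next h = q}) (n : ℕ) :
    CountablyValued fun ω : R × (ℕ → Bool) => play P (σ ω.1) (τ ω.1) ω.2 n := by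
  have hcoin : ∀ s, CountablyValued fun ω : R × (ℕ → Bool) => ω.2 s := fun s =>
    .of_countable fun b => by
      have : Measurable fun ω : R × (ℕ → Bool) => ω.2 s := by fun_prop
      exact this (measurableSet_singleton b)
  have hnext : ∀ h, CountablyValued fun ω : R × (ℕ → Bool) => (τ ω.1).next h := fun h =>
    .of_countable fun q => measurable_fst (hτ h q)
  induction n with
  | zero =>
    have h0 : CountablyValued fun ω : R × (ℕ → Bool) => (τ ω.1).secret :=
      .of_countable fun N => measurable_fst (hτ₀ N)
    exact (hcoin 0).bind (F := fun b ω =>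
      (start fun Q => if Q = P then some b.toNat else (τ ω.1).secret, [])) fun b =>
        h0.comp fun N => (start fun Q => if Q = P then some b.toNat else N, [])
  | succ n ih =>
    refine ih.bind (F := fun p ω =>
      let mN := (τ ω.1).next ((p.1 :: p.2).map (Config.opponentView P))
      if Allowed P (σ ω.1 ((p.1 :: p.2).map (Config.ownView P))) mN.1 then
        ((p.1.step mN.1 (chosen P ω.2 mN.1 mN.2)).getD p.1, p.1 :: p.2)
      else (p.1, p.1 :: p.2)) fun p => ?_
    refine (hnext ((p.1 :: p.2).map (Config.opponentView P))).bind (F := fun mN ω =>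
      if Allowed P (σ ω.1 ((p.1 :: p.2).map (Config.ownView P))) mN.1 then
        ((p.1.step mN.1 (chosen P ω.2 mN.1 mN.2)).getD p.1, p.1 :: p.2)
      else (p.1, p.1 :: p.2)) fun mN => ?_
    have hA : CountablyValued fun ω : R × (ℕ → Bool) =>
        Allowed P (σ ω.1 ((p.1 :: p.2).map (Config.ownView P))) mN.1 := by
      have hm : MeasurableSet {ω : R × (ℕ → Bool) |
          Allowed P (σ ω.1 ((p.1 :: p.2).map (Config.ownView P))) mN.1} :=
        (measurable_fst (hσ _ mN.1)).union (MeasurableSet.const _)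
      refine .of_countable fun q => ?_
      by_cases hq : q
      · convert! hm using 1
        ext ω
        simp [hq]
      · convert! hm.compl using 1
        ext ω
        simp [hq]
    refine hA.bind (F := fun q ω => if q then
        ((p.1.step mN.1 (chosen P ω.2 mN.1 mN.2)).getD p.1, p.1 :: p.2)
      else (p.1, p.1 :: p.2)) fun q => ?_
    have hc : CountablyValued fun ω : R × (ℕ → Bool) => chosen P ω.2 mN.1 mN.2 := by
      cases mN.1 with
      | commit Q s => exact (hcoin s).comp fun b => if Q = P then some b.toNat else mN.2
      | _ => exact .const _
    exact hc.comp fun N => if q then ((p.1.step mN.1 N).getD p.1, p.1 :: p.2)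
      else (p.1, p.1 :: p.2)

theorem countablyValued_stipulation
    (hσ : ∀ (h : List Config) (m : Move), MeasurableSet {r | m ∈ σ r h})
    (hτ₀ : ∀ N : Option ℕ, MeasurableSet {r | (τ r).secret = N})
    (hτ : ∀ (h : List Config) (q : Move × Option ℕ), MeasurableSet {r | (τ r).next h = q}) (n : ℕ) :
    CountablyValued fun ω : R × (ℕ → Bool) => stipulation P (σ ω.1) (τ ω.1) ω.2 n := by
  refine (countablyValued_play (P := P) hσ hτ₀ hτ n).bind (F := fun p ω =>
    match ((τ ω.1).next ((p.1 :: p.2).map (Config.opponentView P))).1 with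
    | .init s => if (p.1.init s).isSome then some s else none
    | _ => none) fun p => ?_
  have hnext : ∀ h, CountablyValued fun ω : R × (ℕ → Bool) => (τ ω.1).next h := fun h =>
    .of_countable fun q => measurable_fst (hτ h q)
  exact (hnext ((p.1 :: p.2).map (Config.opponentView P))).comp fun q => match q.1 with
    | .init s => if (p.1.init s).isSome then some s else none
    | _ => none

/-! ### Flipping a coin -/

instance : IsProbabilityMeasure fairCoins := by
  unfold fairCoins
  infer_instance

theorem map_not_uniform :
    ((PMF.uniformOfFintype Bool).toMeasure).map not = (PMF.uniformOfFintype Bool).toMeasure := by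
  rw [PMF.toMeasure_map _ _ (measurable_of_countable _)]
  congr 1
  ext b
  rw [PMF.map_apply, tsum_bool]
  cases b <;> simp

theorem flipAt_flipAt (s : ℕ) (coin : ℕ → Bool) : flipAt s (flipAt s coin) = coin := by
  funext i
  unfold flipAt
  split_ifs <;> simp

theorem measurePreserving_flipAt (s : ℕ) : MeasurePreserving (flipAt s) fairCoins fairCoins := by
  have hf : ∀ i, Measurable (if i = s then not else id : Bool → Bool) := fun _ =>
    measurable_of_countable _
  have e : flipAt s = fun x i => (if i = s then not else id : Bool → Bool) (x i) := by
    funext x i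
    unfold flipAt
    split_ifs <;> rfl
  refine ⟨?_, ?_⟩
  · rw [e]
    exact measurable_pi_lambda _ fun i => (hf i).comp (measurable_pi_apply i)
  · rw [e, fairCoins, Measure.infinitePi_map_pi _ hf]
    congr 1
    funext i
    split_ifs
    · exact map_not_uniform
    · exact Measure.map_id

theorem measurePreserving_prod_flipAt (ρ : Measure R) [IsProbabilityMeasure ρ] (s : ℕ) :
    MeasurePreserving (Prod.map (id : R → R) (flipAt s)) (ρ.prod fairCoins) (ρ.prod fairCoins) :=
  (MeasurePreserving.id ρ).prod (measurePreserving_flipAt s)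

/-! ### Averaging over measure-preserving maps. -/

theorem MeasurePreserving.integral_comp_self {Ω : Type*} [MeasurableSpace Ω] {μ : Measure Ω}
    {F : Ω → Ω} (hF : MeasurePreserving F μ μ) {g : Ω → ℝ} (hg : AEStronglyMeasurable g μ) :
    ∫ ω, g (F ω) ∂μ = ∫ ω, g ω ∂μ := by
  have hg' : AEStronglyMeasurable g (μ.map F) := by rwa [hF.map_eq]
  have := integral_map hF.measurable.aemeasurable hg'
  rw [hF.map_eq] at this
  exact this.symm

theorem integral_nonneg_of_involution {Ω : Type*} [MeasurableSpace Ω] {μ : Measure Ω} {F : Ω → Ω}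
    (hF : MeasurePreserving F μ μ) {g : Ω → ℝ} (hg : Integrable g μ)
    (h : ∀ ω, 0 ≤ g ω + g (F ω)) : 0 ≤ ∫ ω, g ω ∂μ := by
  have h1 := MeasurePreserving.integral_comp_self hF hg.aestronglyMeasurable
  have h2 : 0 ≤ ∫ ω, (g ω + g (F ω)) ∂μ := integral_nonneg h
  have hg' : Integrable (fun ω => g (F ω)) μ := hF.integrable_comp_of_integrable hg
  rw [integral_add hg hg', h1] at h2
  linarith

/-- The stipulated session depends on the outcome, so no single coin can be flipped throughout. Each
event `I = some s` is invariant under its own flip `F s` and is averaged separately. -/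
theorem integral_nonneg_of_partition {Ω : Type*} [MeasurableSpace Ω] {μ : Measure Ω}
    {Y : Ω → ℝ} (hY : Integrable Y μ) {I : Ω → Option ℕ} (hI : ∀ i, MeasurableSet (I ⁻¹' {i}))
    {F : ℕ → Ω → Ω} (hF : ∀ s, MeasurePreserving (F s) μ μ) (hFF : ∀ s ω, F s (F s ω) = ω)
    (hIF : ∀ ω s, I ω = some s → I (F s ω) = some s) (h0 : ∀ ω, I ω = none → 0 ≤ Y ω)
    (h1 : ∀ ω s, I ω = some s → 0 ≤ Y ω + Y (F s ω)) : 0 ≤ ∫ ω, Y ω ∂μ := by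
  have hU : ⋃ i, I ⁻¹' {i} = Set.univ := by
    ext ω
    simp
  have hd : Pairwise (Function.onFun Disjoint fun i => I ⁻¹' {i}) := fun i j hij =>
    Disjoint.preimage _ (by simpa using hij)
  rw [← setIntegral_univ, ← hU, integral_iUnion hI hd hY.integrableOn]
  refine tsum_nonneg fun i => ?_
  cases i with
  | none => exact setIntegral_nonneg (hI none) h0
  | some s =>
    rw [← integral_indicator (hI (some s))]
    refine integral_nonneg_of_involution (hF s) (hY.indicator (hI (some s))) fun ω => ?_
    by_cases hω : I ω = some s
    · rw [Set.indicator_of_mem (show ω ∈ I ⁻¹' {some s} from hω),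
        Set.indicator_of_mem (show F s ω ∈ I ⁻¹' {some s} from hIF ω s hω)]
      exact h1 ω s hω
    · have hω' : ¬ I (F s ω) = some s := fun e => hω (by simpa [hFF] using hIF _ s e)
      rw [Set.indicator_of_notMem (show ω ∉ I ⁻¹' {some s} from hω),
        Set.indicator_of_notMem (show F s ω ∉ I ⁻¹' {some s} from hω'), add_zero]

end BitML

namespace BitML

/-! ### The limit of the play -/

section limit

variable {P : Player} {σ : Strategy} {τ : Opponent} {coin : ℕ → Bool} {c c' : Config}

theorem Config.time_step {m : Move} {N : Option ℕ} (hi : c.step m N = some c') :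
    c'.time = c.time ∨ m = .tick ∧ c'.time = c.time + 1 := by
  cases m with
  | tick =>
    obtain rfl := Option.some.inj hi
    exact Or.inr ⟨rfl, rfl⟩
  | fire x i =>
    obtain ⟨a, D, -, -, -, ⟨_, _, _, -, -, -, rfl⟩ | ⟨_, -, rfl⟩ | ⟨_, -, -, rfl⟩⟩ :=
      Config.fire_eq_some hi <;> exact Or.inl rfl
  | advertise x i =>
    obtain ⟨a, D, X, k, -, -, -, rfl⟩ := Config.advertise_eq_some hi
    exact Or.inl rfl
  | init t =>
    obtain ⟨d, a, -, -, -, rfl⟩ := Config.init_eq_some hi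
    exact Or.inl rfl
  | commit Q t | authorize Q t | reveal Q t =>
    simp only [Config.step] at hi
    split at hi
    · obtain rfl := Option.some.inj hi
      exact Or.inl rfl
    · cases hi

theorem time_play_succ (n : ℕ) :
    (play P σ τ coin (n + 1)).1.time = (play P σ τ coin n).1.time ∨
      Permitted P σ τ coin n ∧ (choice P σ τ coin n).1 = .tick ∧
        (play P σ τ coin (n + 1)).1.time = (play P σ τ coin n).1.time + 1 := by
  rcases play_step (P := P) (σ := σ) (τ := τ) (coin := coin) n with e | ⟨hp, e⟩
  · rw [e]; exact Or.inl rfl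
  · exact (Config.time_step e).imp id fun h => ⟨hp, h⟩

theorem time_play_mono : Monotone fun n => (play P σ τ coin n).1.time :=
  monotone_nat_of_le_succ fun n => by
    rcases time_play_succ (P := P) (σ := σ) (τ := τ) (coin := coin) n with h | ⟨-, -, h⟩ <;> omega

/-- Time grows only by permitted ticks, and at such a moment no move of `P` is due. -/
theorem exists_tick (ht : TimeDiverges (play P σ τ coin)) (n : ℕ) :
    ∃ m, n ≤ m ∧ Permitted P σ τ coin m ∧ (choice P σ τ coin m).1 = .tick := by
  by_contra hno
  push Not at hno
  have hconst : ∀ k, (play P σ τ coin (n + k)).1.time = (play P σ τ coin n).1.time := by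
    intro k
    induction k with
    | zero => rfl
    | succ k ih =>
      rcases time_play_succ (P := P) (σ := σ) (τ := τ) (coin := coin) (n + k) with
        h | ⟨h1, h2, -⟩
      · exact h.trans ih
      · exact absurd h2 (hno _ (Nat.le_add_right _ _) h1)
  obtain ⟨m, hm⟩ := ht ((play P σ τ coin n).1.time + 1)
  have h1 := time_play_mono (P := P) (σ := σ) (τ := τ) (coin := coin) (Nat.le_add_left m n)
  have h2 := hconst m
  dsimp only at h1
  omega

theorem bddAbove_received (hσ : Rational P σ) :
    BddAbove (Set.range fun n => ((play P σ τ coin n).1.received P : ℝ)) :=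
  ⟨6, by rintro _ ⟨n, rfl⟩; exact (inv_play hσ n).received_le⟩

theorem iSup_received_nonneg (P : Player) (run : ℕ → Config × List Config) :
    0 ≤ ⨆ n, ((run n).1.received P : ℝ) :=
  Real.iSup_nonneg fun _ => Nat.cast_nonneg _

theorem iSup_received_le (hσ : Rational P σ) :
    ⨆ n, ((play P σ τ coin n).1.received P : ℝ) ≤ 6 :=
  ciSup_le fun n => (inv_play hσ n).received_le

/-- Past the horizon the potential never drops, and at the next tick it equals the amount received.
-/
theorem potential_le_iSup_received (hσ : Rational P σ) (ht : TimeDiverges (play P σ τ coin))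
    {n K : ℕ} (hn : 3 * K < (play P σ τ coin n).1.time) :
    potential K P (play P σ τ coin n).1 ≤ ⨆ n, ((play P σ τ coin n).1.received P : ℝ) := by
  obtain ⟨m, hnm, hp, hm⟩ := exists_tick ht n
  have hlate : ∀ k, n ≤ k → 3 * K < (play P σ τ coin k).1.time := fun k hk =>
    hn.trans_le (time_play_mono hk)
  have h1 : potential K P (play P σ τ coin n).1 ≤ potential K P (play P σ τ coin m).1 :=
    Nat.le_induction (P := fun m _ =>
      potential K P (play P σ τ coin n).1 ≤ potential K P (play P σ τ coin m).1) le_rfl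
      (fun k hk ih => ih.trans (potential_play_le hσ (Or.inr (hlate k hk)))) m hnm
  rw [(inv_play hσ m).potential_eq_received (not_due_of_permitted hσ hp hm) (hlate m hnm)] at h1
  exact h1.trans (le_ciSup (bddAbove_received hσ) m)

theorem potential_start_flipAt (K : ℕ) :
    6 - 16 / 2 ^ K ≤ potential K P (play P σ τ coin 0).1 +
      potential K P (play P σ τ (flipAt 0 coin) 0).1 := by
  simp only [play, potential_start]
  exact start_le_winner_average K (x := coin 0) (by simp) (by simp [flipAt]) (by simp)

end limit

/-! ### Expectations -/

section expectation

variable {R : Type*} [MeasurableSpace R] {ρ : Measure R} [IsProbabilityMeasure ρ]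
  {P : Player} {σ : R → Strategy} {τ : R → Opponent}

theorem integrable_of_measurable_of_le {Ω : Type*} [MeasurableSpace Ω] {μ : Measure Ω}
    [IsFiniteMeasure μ] {f : Ω → ℝ} (hf : Measurable f) {C : ℝ} (h0 : ∀ ω, 0 ≤ f ω)
    (hC : ∀ ω, f ω ≤ C) : Integrable f μ :=
  Integrable.of_bound hf.aestronglyMeasurable C (Filter.Eventually.of_forall fun ω => by
    rw [Real.norm_of_nonneg (h0 ω)]; exact hC ω)

theorem integrable_potential
    (hσ : ∀ (h : List Config) (m : Move), MeasurableSet {r | m ∈ σ r h})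
    (hτ₀ : ∀ N : Option ℕ, MeasurableSet {r | (τ r).secret = N})
    (hτ : ∀ (h : List Config) (q : Move × Option ℕ), MeasurableSet {r | (τ r).next h = q})
    (hrat : ∀ r, Rational P (σ r)) (K n : ℕ) :
    Integrable (fun ω : R × (ℕ → Bool) => potential K P (play P (σ ω.1) (τ ω.1) ω.2 n).1)
      (ρ.prod fairCoins) :=
  integrable_of_measurable_of_le
    ((countablyValued_play hσ hτ₀ hτ n).measurable_comp fun p => potential K P p.1)
    (fun _ => potential_nonneg _ _ _) fun ω => (inv_play (hrat ω.1) n).potential_le K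

/-- The base case averages over the coin of session 0, the induction step over the coin of the
session stipulated at that step, if any. -/
theorem le_integral_potential
    (hσ : ∀ (h : List Config) (m : Move), MeasurableSet {r | m ∈ σ r h})
    (hτ₀ : ∀ N : Option ℕ, MeasurableSet {r | (τ r).secret = N})
    (hτ : ∀ (h : List Config) (q : Move × Option ℕ), MeasurableSet {r | (τ r).next h = q})
    (hrat : ∀ r, Rational P (σ r)) (K n : ℕ) :
    3 - 8 / 2 ^ K ≤ ∫ ω : R × (ℕ → Bool), potential K P (play P (σ ω.1) (τ ω.1) ω.2 n).1
      ∂(ρ.prod fairCoins) := by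
  have hint := fun n => integrable_potential (ρ := ρ) hσ hτ₀ hτ hrat K n
  induction n with
  | zero =>
    have h := integral_nonneg_of_involution (measurePreserving_prod_flipAt ρ 0)
      ((hint 0).sub (integrable_const (3 - 8 / 2 ^ K : ℝ))) (fun ω => by
        have := potential_start_flipAt (P := P) (σ := σ ω.1) (τ := τ ω.1) (coin := ω.2) K
        have e : (16 : ℝ) / 2 ^ K = 2 * (8 / 2 ^ K) := by ring
        simp only [Pi.sub_apply, Prod.map_fst, Prod.map_snd, id_eq]
        linarith)
    simp only [Pi.sub_apply] at h
    rw [integral_sub (hint 0) (integrable_const _)] at h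
    simp only [integral_const, probReal_univ, one_smul] at h
    linarith
  | succ n ih =>
    have h := integral_nonneg_of_partition ((hint (n + 1)).sub (hint n))
      (I := fun ω => stipulation P (σ ω.1) (τ ω.1) ω.2 n)
      (countablyValued_stipulation hσ hτ₀ hτ n).2 (measurePreserving_prod_flipAt ρ)
      (fun s ω => by simp [Prod.map, flipAt_flipAt])
      (fun ω s hs => stipulation_flipAt (hrat ω.1) hs)
      (fun ω hω => sub_nonneg.2 (potential_play_le (hrat ω.1) (Or.inl hω)))
      (fun ω s hs => by
        have := potential_stipulation (hrat ω.1) hs K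
        simp only [Pi.sub_apply, Prod.map_fst, Prod.map_snd, id_eq]
        linarith)
    simp only [Pi.sub_apply] at h
    rw [integral_sub (hint (n + 1)) (hint n)] at h
    linarith

theorem integrable_iSup_received
    (hσ : ∀ (h : List Config) (m : Move), MeasurableSet {r | m ∈ σ r h})
    (hτ₀ : ∀ N : Option ℕ, MeasurableSet {r | (τ r).secret = N})
    (hτ : ∀ (h : List Config) (q : Move × Option ℕ), MeasurableSet {r | (τ r).next h = q})
    (hrat : ∀ r, Rational P (σ r)) :
    Integrable (fun ω : R × (ℕ → Bool) =>
      ⨆ n, ((play P (σ ω.1) (τ ω.1) ω.2 n).1.received P : ℝ)) (ρ.prod fairCoins) :=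
  integrable_of_measurable_of_le
    (Measurable.iSup fun n => (countablyValued_play hσ hτ₀ hτ n).measurable_comp fun p =>
      (p.1.received P : ℝ))
    (fun _ => iSup_received_nonneg _ _) fun ω => iSup_received_le (hrat ω.1)

/-- The potential need not converge. It suffices that its excess over the final receipts is at most
6 and almost surely eventually zero, so that the expected excess tends to 0 by dominated
convergence. -/
theorem le_integral_iSup_received
    (hσ : ∀ (h : List Config) (m : Move), MeasurableSet {r | m ∈ σ r h})
    (hτ₀ : ∀ N : Option ℕ, MeasurableSet {r | (τ r).secret = N})
    (hτ : ∀ (h : List Config) (q : Move × Option ℕ), MeasurableSet {r | (τ r).next h = q})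
    (hrat : ∀ r, Rational P (σ r))
    (htime : ∀ᵐ ω ∂(ρ.prod fairCoins), TimeDiverges (play P (σ ω.1) (τ ω.1) ω.2)) (K : ℕ) :
    3 - 8 / 2 ^ K ≤ ∫ ω : R × (ℕ → Bool),
      ⨆ n, ((play P (σ ω.1) (τ ω.1) ω.2 n).1.received P : ℝ) ∂(ρ.prod fairCoins) := by
  set S : R × (ℕ → Bool) → ℝ := fun ω =>
    ⨆ n, ((play P (σ ω.1) (τ ω.1) ω.2 n).1.received P : ℝ) with hS
  set X : ℕ → R × (ℕ → Bool) → ℝ := fun n ω =>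
    potential K P (play P (σ ω.1) (τ ω.1) ω.2 n).1 with hX
  have hSi : Integrable S (ρ.prod fairCoins) := integrable_iSup_received hσ hτ₀ hτ hrat
  have hXi : ∀ n, Integrable (X n) (ρ.prod fairCoins) :=
    integrable_potential hσ hτ₀ hτ hrat K
  have hmax : ∀ n, Integrable (fun ω => max (X n ω - S ω) 0) (ρ.prod fairCoins) := fun n =>
    ((hXi n).sub hSi).pos_part
  have hlim : Filter.Tendsto (fun n => ∫ ω, max (X n ω - S ω) 0 ∂(ρ.prod fairCoins)) Filter.atTop
      (nhds (∫ _, (0 : ℝ) ∂(ρ.prod fairCoins))) := by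
    refine tendsto_integral_of_dominated_convergence (fun _ => 6)
      (fun n => (hmax n).aestronglyMeasurable) (integrable_const _) ?_ ?_
    · refine fun n => Filter.Eventually.of_forall fun ω => ?_
      rw [Real.norm_of_nonneg (le_max_right _ _)]
      have h1 : X n ω ≤ 6 := (inv_play (hrat ω.1) n).potential_le K
      have h2 : 0 ≤ S ω := iSup_received_nonneg _ _
      exact max_le (by linarith) (by norm_num)
    · filter_upwards [htime] with ω hω
      obtain ⟨m, hm⟩ := hω (3 * K + 1)
      refine tendsto_const_nhds.congr' ?_
      filter_upwards [Filter.eventually_ge_atTop m] with n hn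
      have hn' := time_play_mono (P := P) (σ := σ ω.1) (τ := τ ω.1) (coin := ω.2) hn
      have : X n ω ≤ S ω := potential_le_iSup_received (hrat ω.1) hω
        (lt_of_lt_of_le (Nat.lt_of_succ_le hm) hn')
      exact (max_eq_right (by linarith)).symm
  rw [integral_zero] at hlim
  have hle : ∀ n, 3 - 8 / 2 ^ K - ∫ ω, S ω ∂(ρ.prod fairCoins) ≤
      ∫ ω, max (X n ω - S ω) 0 ∂(ρ.prod fairCoins) := by
    intro n
    have h1 : 3 - 8 / 2 ^ K ≤ ∫ ω, X n ω ∂(ρ.prod fairCoins) :=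
      le_integral_potential hσ hτ₀ hτ hrat K n
    have h2 : ∫ ω, (X n ω - S ω) ∂(ρ.prod fairCoins) ≤
        ∫ ω, max (X n ω - S ω) 0 ∂(ρ.prod fairCoins) :=
      integral_mono ((hXi n).sub hSi) (hmax n) fun ω => le_max_left _ _
    rw [integral_sub (hXi n) hSi] at h2
    linarith
  have := ge_of_tendsto' hlim hle
  linarith

end expectation

end BitML

theorem mainTheorem2 {R : Type*} [MeasurableSpace R] (ρ : Measure R) [IsProbabilityMeasure ρ]
    (P : BitML.Player) (σ : R → BitML.Strategy) (τ : R → BitML.Opponent)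
    (hσ : ∀ (h : List BitML.Config) (m : BitML.Move), MeasurableSet {r | m ∈ σ r h})
    (hτ₀ : ∀ N : Option ℕ, MeasurableSet {r | (τ r).secret = N})
    (hτ : ∀ (h : List BitML.Config) (q : BitML.Move × Option ℕ),
      MeasurableSet {r | (τ r).next h = q})
    (hrat : ∀ r, BitML.Rational P (σ r))
    (htime : ∀ᵐ ω ∂(ρ.prod BitML.fairCoins),
      BitML.TimeDiverges (BitML.play P (σ ω.1) (τ ω.1) ω.2)) :
    (Integrable (fun ω : R × (ℕ → Bool) =>
        BitML.payoff P (BitML.play P (σ ω.1) (τ ω.1) ω.2)) (ρ.prod BitML.fairCoins) ∧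
      0 ≤ ∫ ω : R × (ℕ → Bool),
        BitML.payoff P (BitML.play P (σ ω.1) (τ ω.1) ω.2) ∂(ρ.prod BitML.fairCoins)) ∧
    (∀ p : ℝ, p = 1 / 2 * 6 + 1 / 2 * (1 / 2 * p) ↔ p = 4) := by
  have hint := BitML.integrable_iSup_received (ρ := ρ) hσ hτ₀ hτ hrat
  refine ⟨⟨hint.sub (integrable_const 3), ?_⟩, fun p => ⟨fun h => by linarith, fun h => by
    rw [h]; norm_num⟩⟩
  unfold BitML.payoff
  rw [integral_sub hint (integrable_const 3)]
  simp only [integral_const, probReal_univ, one_smul, sub_nonneg]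
  have hlim : Filter.Tendsto (fun K : ℕ => (3 : ℝ) - 8 / 2 ^ K) Filter.atTop (nhds (3 - 0)) :=
    tendsto_const_nhds.sub (tendsto_const_nhds.div_atTop
      (tendsto_pow_atTop_atTop_of_one_lt (by norm_num)))
  rw [sub_zero] at hlim
  exact le_of_tendsto' hlim fun K =>
    BitML.le_integral_iSup_received hσ hτ₀ hτ hrat htime K
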